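/- Theorem 4.5. Logarithms are to base 2. There is an ancestry-labeling scheme for the family of all rooted forests, that is, a marker, which assigns a bit string $L_F(v)$ (a label) to each node $v$ of each finite rooted forest $F$, together with a decoder $D$, which maps pairs of bit strings to $\{0,1\}$ and does not depend on the forest, such that for every forest $F$ and all nodes $u,v$ of $F$ $$D(L_F(u),L_F(v))=1 \iff u \text{ is an ancestor of } v \text{ in } F$$ (each node being an ancestor of itself), with the following properties. (1) Label size: every label of a node of an $n$-node forest has at most $$\log n+3\log\log n+O(\log\log\log n)$$ bits, as $n\to\infty$. (2) Labeling time: given an $n$-node forest (by its number of nodes and its array of parents), the labels of all its nodes can be computed in $O(n)$ time. (3) Query time: given two labels of nodes of forests with at most $n$ nodes, the value of $D$ on them can be computed in constant time. Times refer to the word RAM whose unit-cost operations on words are addition, subtraction, multiplication, integer division, left and right shifts, less-than comparison, extraction of the index of the least significant 1-bit, and memory access. There are one labeling program, one query program and one constant $c$ such that, for every $n$ and every word length $w\ge c(\lfloor\log n\rfloor+1)$ (where $\lfloor\log 0\rfloor$ is read as $0$), the programs run within $c(n+1)$ steps and $c$ steps, respectively. A label is given to, and returned by, a program as its length and the number that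 its bits represent. -/

import Mathlib

/-! ### Rooted forests -/

/-- A rooted forest on the node set `Fin n`, given by its parent function (`none` at the roots).
Well-foundedness of "`u` is the parent of `v`" says that following parents always ends at a root. -/
structure RootedForest (n : ℕ) where
  parent : Fin n → Option (Fin n)
  acyclic : WellFounded fun u v : Fin n => parent v = some u

/-- `u` is an ancestor of `v` (every node is an ancestor of itself). -/
def RootedForest.IsAncestor {n : ℕ} (F : RootedForest n) (u v : Fin n) : Prop :=
  Relation.ReflTransGen (fun x y => F.parent y = some x) u v

/-! ### Ancestry-labeling schemes -/

/-- An ancestry-labeling scheme for the family of all rooted forests: a marker, which gives a bit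
string to each node of each forest, and a decoder, which sees two bit strings and nothing else. -/
structure AncestryLabelingScheme where
  label : ∀ {n : ℕ}, RootedForest n → Fin n → List Bool
  decode : List Bool → List Bool → Bool
  correct : ∀ {n : ℕ} (F : RootedForest n) (u v : Fin n),
    decode (label F u) (label F v) = true ↔ F.IsAncestor u v

/-! ### The word RAM

Structured programs over finitely many word variables ("registers") and finitely many arrays of
words with indirect addressing.  The word length `w` is a parameter of the semantics, not of the
program.  Every operation, memory access and test costs at least one step. -/

namespace WordRAM

/-- Contents of the registers and of the arrays: `arr a i` is cell `i` of array number `a`. -/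
structure State where
  reg : ℕ → ℕ
  arr : ℕ → ℕ → ℕ

/-- The binary operations: arithmetic, left and right shift, and the less-than test. -/
inductive Op
  | add | sub | mul | div | shl | shr | lt

/-- The value of an operation on `w`-bit words.  Results are reduced modulo `2 ^ w`; subtraction is
cut off at `0`, division is rounded down (with `x / 0 = 0`), and `lt` returns `1` or `0`. -/
def Op.eval (w : ℕ) : Op → ℕ → ℕ → ℕ
  | .add, x, y => (x + y) % 2 ^ w
  | .sub, x, y => x - y
  | .mul, x, y => (x * y) % 2 ^ w
  | .div, x, y => x / y
  | .shl, x, y => (x * 2 ^ y) % 2 ^ w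
  | .shr, x, y => x / 2 ^ y
  | .lt, x, y => if x < y then 1 % 2 ^ w else 0

/-- Expressions: numerals, registers, array cells, binary operations, and the index of the least
significant 1-bit. -/
inductive Expr
  | const (c : ℕ)
  | reg (r : ℕ)
  | load (a : ℕ) (i : Expr)
  | op (o : Op) (e₁ e₂ : Expr)
  | lsb (e : Expr)

/-- The value of an expression.  `padicValNat 2 x`, the largest `k` with `2 ^ k ∣ x`, is the index
of the least significant 1-bit of `x` (and `0` for `x = 0`). -/
def Expr.eval (w : ℕ) (s : State) : Expr → ℕ
  | .const c => c % 2 ^ w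
  | .reg r => s.reg r
  | .load a i => s.arr a (i.eval w s)
  | .op o e₁ e₂ => o.eval w (e₁.eval w s) (e₂.eval w s)
  | .lsb e => padicValNat 2 (e.eval w s)

/-- The number of steps needed to evaluate an expression: one for each of its nodes. -/
def Expr.cost : Expr → ℕ
  | .const _ => 1
  | .reg _ => 1
  | .load _ i => i.cost + 1
  | .op _ e₁ e₂ => e₁.cost + e₂.cost + 1
  | .lsb e => e.cost + 1

/-- Programs. `assign r e` writes to register `r`; `store a i e` writes to cell `i` of array `a`;
a test succeeds when its value is not `0`. -/
inductive Program
  | skip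
  | assign (r : ℕ) (e : Expr)
  | store (a : ℕ) (i e : Expr)
  | seq (p q : Program)
  | ite (e : Expr) (p q : Program)
  | loop (e : Expr) (p : Program)

/-- The state after writing the value `x` to register `r`. -/
def State.setReg (s : State) (r x : ℕ) : State :=
  { s with reg := Function.update s.reg r x }

/-- The state after writing the value `x` to cell `i` of array `a`. -/
def State.setArr (s : State) (a i x : ℕ) : State :=
  { s with arr := Function.update s.arr a (Function.update (s.arr a) i x) }

/-- `Exec w p s t s'`: with word length `w`, the program `p` started in state `s` halts after
exactly `t` steps in state `s'`.  (`loop e p` is "while `e`, do `p`".) -/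
inductive Exec (w : ℕ) : Program → State → ℕ → State → Prop
  | skip (s : State) : Exec w .skip s 1 s
  | assign (r : ℕ) (e : Expr) (s : State) :
      Exec w (.assign r e) s (e.cost + 1) (s.setReg r (e.eval w s))
  | store (a : ℕ) (i e : Expr) (s : State) :
      Exec w (.store a i e) s (i.cost + e.cost + 1) (s.setArr a (i.eval w s) (e.eval w s))
  | seq {p q : Program} {s s' s'' : State} {t t' : ℕ}
      (hp : Exec w p s t s') (hq : Exec w q s' t' s'') : Exec w (.seq p q) s (t + t') s''
  | ite_true {e : Expr} {p q : Program} {s s' : State} {t : ℕ}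
      (he : e.eval w s ≠ 0) (hp : Exec w p s t s') : Exec w (.ite e p q) s (e.cost + 1 + t) s'
  | ite_false {e : Expr} {p q : Program} {s s' : State} {t : ℕ}
      (he : e.eval w s = 0) (hq : Exec w q s t s') : Exec w (.ite e p q) s (e.cost + 1 + t) s'
  | loop_true {e : Expr} {p : Program} {s s' s'' : State} {t t' : ℕ}
      (he : e.eval w s ≠ 0) (hp : Exec w p s t s') (hl : Exec w (.loop e p) s' t' s'') :
      Exec w (.loop e p) s (e.cost + 1 + t + t') s''
  | loop_false {e : Expr} {p : Program} {s : State}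
      (he : e.eval w s = 0) : Exec w (.loop e p) s (e.cost + 1) s

/-! ### Input and output conventions -/

/-- The number whose binary digits are the given bits, the first bit being the least significant
one.  A bit string is stored as two words: its length and this number. -/
def bitsValue : List Bool → ℕ
  | [] => 0
  | b :: l => b.toNat + 2 * bitsValue l

/-- The input of the marker: the number of nodes in register `0`, and the parent function in array
`0` (`0` for a root, `u + 1` for a node with parent `u`); everything else is `0`. -/
def forestInput {n : ℕ} (F : RootedForest n) : State where
  reg r := if r = 0 then n else 0
  arr a i :=
    if h : a = 0 ∧ i < n then
      match F.parent ⟨i, h.2⟩ with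
      | none => 0
      | some u => (u : ℕ) + 1
    else 0

/-- The input of the decoder: two bit strings, in registers `0`, `1` and `2`, `3`. -/
def queryInput (l₁ l₂ : List Bool) : State where
  reg r :=
    match r with
    | 0 => l₁.length
    | 1 => bitsValue l₁
    | 2 => l₂.length
    | 3 => bitsValue l₂
    | _ => 0
  arr _ _ := 0

/-- With word length `w`, the program assigns the labels of the scheme to the nodes of `F` within
`T` steps, leaving the label of node `v` in cell `v` of arrays `0` (length) and `1` (bits). -/
def AssignsLabels (p : Program) (S : AncestryLabelingScheme) {n : ℕ} (F : RootedForest n)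
    (w T : ℕ) : Prop :=
  ∃ (t : ℕ) (s : State), Exec w p (forestInput F) t s ∧ t ≤ T ∧
    ∀ v : Fin n, s.arr 0 v = (S.label F v).length ∧ s.arr 1 v = bitsValue (S.label F v)

/-- With word length `w`, the program answers the query `(l₁, l₂)` within `T` steps, leaving the
decoder's answer (`1` for true, `0` for false) in register `0`. -/
def AnswersQuery (p : Program) (S : AncestryLabelingScheme) (l₁ l₂ : List Bool)
    (w T : ℕ) : Prop :=
  ∃ (t : ℕ) (s : State), Exec w p (queryInput l₁ l₂) t s ∧ t ≤ T ∧
    s.reg 0 = (S.decode l₁ l₂).toNat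

end WordRAM

/-! Each node `v` gets an integer position, and its label consists of this position and of the
length of a block of positions beginning there that contains the positions of the descendants of `v`
and of no other node; the query program tests whether the position of `v` lies in the block of `u`.
Positions are given out in a depth-first manner, as in the classical scheme with labels of
`2 log n` bits. To save bits, the length of a block is rounded up to about `m = log log n + O(1)`
significant bits and stored as a floating-point number, an exponent and a mantissa of `m + O(1)`
bits each; `m` itself is stored in unary. The label then has `log N + 3 m + O(1)` bits,
where `N` bounds the positions, and it remains to see that `N = O(n)`.

Rounding forces gaps between the blocks of siblings: a child with `x` positions (its width) reserves
`x + x / 2 ^ m` of them (its extent). The child with the largest gap, the heavy child, is placed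
last. The blocks in its subtree may run over the end of the parent's width, since only positions,
not blocks, need to be disjoint, and the gap of an ancestor is at least as large. Hence only light
children cost a factor `1 + 2 ^ (-m)`. A path from the root has at most `log N` light nodes, and
`2 ^ m ≥ 2 log n + O(1)`, so the widths stay within a factor `2` of the subtree sizes
(`ParentTree.width_bounds`). That the blocks are correct is `ParentTree.anc_of_pos_lt`, by induction
from the root downwards: the extents of siblings are disjoint (`ParentTree.offset_separated`).

The width of a node is a symmetric function of the widths of its children, so it does not depend on
the order in which the labeling program treats the nodes. The program therefore computes the widths
in the order in which a queue delivers the nodes, each after its children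
(`ParentTree.IsQueue`), then the offsets of siblings in the order of the node numbers, and then the
positions and labels in the reverse of the order of the queue. The bit length of a number,
which is needed for the exponents and is not an operation of the word RAM, is read from a table. -/

namespace WordRAM

/-! ### Reasoning about programs -/

/-- Total correctness with a time bound: `p` halts from `s` within `T` steps in a state with `Q`. -/
def Runs (w : ℕ) (p : Program) (s : State) (T : ℕ) (Q : State → Prop) : Prop :=
  ∃ (t : ℕ) (s' : State), Exec w p s t s' ∧ t ≤ T ∧ Q s'

variable {w : ℕ} {s : State} {Q : State → Prop}

theorem Runs.mono {p : Program} {T T' : ℕ} {Q' : State → Prop} (h : Runs w p s T Q)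
    (hT : T ≤ T') (hQ : ∀ s', Q s' → Q' s') : Runs w p s T' Q' := by
  obtain ⟨t, s', he, ht, hq⟩ := h
  exact ⟨t, s', he, ht.trans hT, hQ _ hq⟩

theorem Runs.seq {p q : Program} {T T' : ℕ}
    (h : Runs w p s T fun s' => Runs w q s' T' Q) : Runs w (.seq p q) s (T + T') Q := by
  obtain ⟨t, s', he, ht, t', s'', he', ht', hq⟩ := h
  exact ⟨_, _, .seq he he', by omega, hq⟩

/-- A bound for the number of steps of a program without loops. -/
def Program.cost : Program → ℕ
  | .skip => 1
  | .assign _ e => e.cost + 1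
  | .store _ i e => i.cost + e.cost + 1
  | .seq p q => p.cost + q.cost
  | .ite e p q => e.cost + 1 + max p.cost q.cost
  | .loop _ _ => 0

/-- `Runs` with the time bound `Program.cost`, which is read off a program without loops. -/
def Computes (w : ℕ) (p : Program) (s : State) (Q : State → Prop) : Prop := Runs w p s p.cost Q

theorem Computes.runs {p : Program} {T : ℕ} (h : Computes w p s Q) (hT : p.cost ≤ T) :
    Runs w p s T Q :=
  Runs.mono h hT fun _ h => h

theorem Computes.skip (hQ : Q s) : Computes w .skip s Q := ⟨_, _, .skip s, le_rfl, hQ⟩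

theorem Computes.assign {r : ℕ} {e : Expr} (x : ℕ) (hx : e.eval w s = x) (hQ : Q (s.setReg r x)) :
    Computes w (.assign r e) s Q :=
  ⟨_, _, .assign r e s, le_rfl, by rwa [hx]⟩

theorem Computes.store {a : ℕ} {i e : Expr} (j x : ℕ) (hj : i.eval w s = j) (hx : e.eval w s = x)
    (hQ : Q (s.setArr a j x)) : Computes w (.store a i e) s Q :=
  ⟨_, _, .store a i e s, le_rfl, by rwa [hx, hj]⟩

theorem Computes.seq {p q : Program} (h : Computes w p s fun s' => Computes w q s' Q) :
    Computes w (.seq p q) s Q :=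
  Runs.seq h

theorem Computes.seq_assign {r : ℕ} {e : Expr} {q : Program} (x : ℕ) (hx : e.eval w s = x)
    (hQ : Computes w q (s.setReg r x) Q) : Computes w (.seq (.assign r e) q) s Q :=
  .seq (.assign x hx hQ)

theorem Computes.seq_store {a : ℕ} {i e : Expr} {q : Program} (j x : ℕ) (hj : i.eval w s = j)
    (hx : e.eval w s = x) (hQ : Computes w q (s.setArr a j x) Q) :
    Computes w (.seq (.store a i e) q) s Q :=
  .seq (.store j x hj hx hQ)

theorem Computes.ite {e : Expr} {p q : Program} (h : e.eval w s ≠ 0 → Computes w p s Q)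
    (h' : e.eval w s = 0 → Computes w q s Q) : Computes w (.ite e p q) s Q := by
  by_cases he : e.eval w s = 0
  · obtain ⟨t, s', hx, ht, hq⟩ := h' he
    exact ⟨_, _, .ite_false he hx, by simp only [Program.cost]; omega, hq⟩
  · obtain ⟨t, s', hx, ht, hq⟩ := h he
    exact ⟨_, _, .ite_true he hx, by simp only [Program.cost]; omega, hq⟩

/-- A loop that makes exactly `N` rounds, with an invariant indexed by the number of rounds. -/
theorem Runs.loop {e : Expr} {p : Program} {T N : ℕ} (I : ℕ → State → Prop) (h0 : I 0 s)
    (hstep : ∀ k < N, ∀ s, I k s → e.eval w s ≠ 0 ∧ Runs w p s T (I (k + 1)))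
    (hend : ∀ s, I N s → e.eval w s = 0) (hQ : ∀ s, I N s → Q s) :
    Runs w (.loop e p) s ((N + 1) * (e.cost + 1 + T)) Q := by
  have key : ∀ d k s, k + d = N → I k s →
      Runs w (.loop e p) s ((d + 1) * (e.cost + 1 + T)) Q := by
    intro d
    induction d with
    | zero =>
      intro k s hk hI
      obtain rfl : k = N := by omega
      exact ⟨_, _, .loop_false (hend s hI), by simp, hQ s hI⟩
    | succ d ih =>
      intro k s hk hI
      obtain ⟨he, t, s', hx, ht, hI'⟩ := hstep k (by omega) s hI
      obtain ⟨t', s'', hx', ht', hq⟩ := ih (k + 1) s' (by omega) hI'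
      refine ⟨_, _, .loop_true he hx hx', ?_, hq⟩
      rw [add_mul (d + 1) 1]
      omega
  exact key N 0 s (by omega) h0

@[simp] theorem State.setReg_reg (s : State) (r x r' : ℕ) :
    (s.setReg r x).reg r' = if r' = r then x else s.reg r' := by
  simp [State.setReg, Function.update_apply]

@[simp] theorem State.setReg_arr (s : State) (r x : ℕ) : (s.setReg r x).arr = s.arr := rfl

@[simp] theorem State.setArr_reg (s : State) (a i x : ℕ) : (s.setArr a i x).reg = s.reg := rfl

@[simp] theorem State.setArr_arr (s : State) (a i x a' i' : ℕ) :
    (s.setArr a i x).arr a' i' = if a' = a ∧ i' = i then x else s.arr a' i' := by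
  simp only [State.setArr, Function.update_apply]
  split_ifs <;> simp_all

end WordRAM

/-! ### Widths and positions in a rooted tree -/

/-- A rooted tree on the nodes `0, …, n` with root `0`, given by its parent function. A forest on
`n` nodes becomes such a tree when its nodes are renumbered `1, …, n` and its roots are attached
to the extra node `0`. The values of `par` outside `1, …, n` are irrelevant. -/
structure ParentTree (n : ℕ) where
  par : ℕ → ℕ
  depth : ℕ → ℕ
  par_le : ∀ v, 1 ≤ v → v ≤ n → par v ≤ n
  depth_par : ∀ v, 1 ≤ v → v ≤ n → depth (par v) < depth v

namespace ParentTree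

variable {n : ℕ} (T : ParentTree n) (m : ℕ)

/-- The children of a node. -/
def kids (u : ℕ) : Finset ℕ := {v ∈ Finset.Icc 1 n | T.par v = u}

theorem mem_kids {u v : ℕ} : v ∈ T.kids u ↔ (1 ≤ v ∧ v ≤ n) ∧ T.par v = u := by
  simp [kids]

theorem mem_kids_par {v : ℕ} (h1 : 1 ≤ v) (h2 : v ≤ n) : v ∈ T.kids (T.par v) :=
  T.mem_kids.2 ⟨⟨h1, h2⟩, rfl⟩

/-- The depth of the deepest node. -/
def height : ℕ := (Finset.range (n + 1)).sup T.depth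

theorem depth_le_height {v : ℕ} (h : v ≤ n) : T.depth v ≤ T.height :=
  Finset.le_sup (f := T.depth) (by simp; omega)

theorem height_sub_lt {u v : ℕ} (h : v ∈ T.kids u) :
    T.height - T.depth v < T.height - T.depth u := by
  obtain ⟨⟨h1, h2⟩, rfl⟩ := T.mem_kids.1 h
  have := T.depth_par v h1 h2
  have := T.depth_le_height h2
  omega

theorem kids_induction {P : ℕ → Prop} (h : ∀ v, (∀ c ∈ T.kids v, P c) → P v) (v : ℕ) : P v :=
  h v fun c _ => kids_induction h c
termination_by T.height - T.depth v
decreasing_by exact T.height_sub_lt ‹_›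

theorem par_induction {P : ℕ → Prop} (h0 : P 0)
    (h : ∀ v, 1 ≤ v → v ≤ n → P (T.par v) → P v) (v : ℕ) (hv : v ≤ n) : P v := by
  induction hd : T.depth v using Nat.strong_induction_on generalizing v with
  | _ d ih =>
    rcases Nat.eq_zero_or_pos v with rfl | h1
    · exact h0
    · exact h v h1 hv (ih _ (hd ▸ T.depth_par v h1 hv) _ (T.par_le v h1 hv) rfl)

/-- The width of a node `v`: one more than the largest offset, relative to `v`, of the position of
a node below `v`. It is the sum of `1` and of the extents `x + x / 2 ^ m` of the children, `x` the
width, except that the child placed last gets only its width. The latter is the child with the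
largest `x / 2 ^ m`; ties are broken by the node number, which is why the maximum is taken over
the keys `x / 2 ^ m * (n + 1) + c`. -/
def width (v : ℕ) : ℕ :=
  1 + ∑ c ∈ (T.kids v).attach, (width c + width c / 2 ^ m) -
    ((T.kids v).attach.sup fun c => width c / 2 ^ m * (n + 1) + c) / (n + 1)
termination_by T.height - T.depth v
decreasing_by all_goals exact T.height_sub_lt c.2

/-- The room left after the last position below `v` for rounding up the widths below `v`. -/
def slack (v : ℕ) : ℕ := T.width m v / 2 ^ m

/-- The length of the block of positions reserved for `v`, unless `v` is a heavy child. -/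
def extent (v : ℕ) : ℕ := T.width m v + T.slack m v

/-- The key that the heavy child of a node maximizes. -/
def key (v : ℕ) : ℕ := T.slack m v * (n + 1) + v

/-- The key of the heavy child of `v` (and `0` at a leaf). -/
def topKey (v : ℕ) : ℕ := (T.kids v).sup (T.key m)

/-- The sum of the extents of the children. -/
def kidsExtent (v : ℕ) : ℕ := ∑ c ∈ T.kids v, T.extent m c

theorem width_eq (v : ℕ) :
    T.width m v = 1 + T.kidsExtent m v - T.topKey m v / (n + 1) := by
  rw [width, kidsExtent, topKey]
  congr 1
  · congr 1
    exact Finset.sum_attach (T.kids v) fun c => T.extent m c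
  · congr 1
    refine le_antisymm (Finset.sup_le fun c _ => ?_) (Finset.sup_le fun c hc => ?_)
    · exact Finset.le_sup (f := T.key m) c.2
    · exact Finset.le_sup (f := fun c : {x // x ∈ T.kids v} =>
        T.width m c / 2 ^ m * (n + 1) + c) (Finset.mem_attach _ ⟨c, hc⟩)

theorem key_div {v : ℕ} (h : v ≤ n) : T.key m v / (n + 1) = T.slack m v := by
  rw [key, mul_comm, Nat.mul_add_div (by omega), Nat.div_eq_of_lt (by omega), add_zero]

theorem key_injOn {u v : ℕ} (hu : u ≤ n) (hv : v ≤ n) (h : T.key m u = T.key m v) : u = v := by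
  have h1 : T.key m u % (n + 1) = u := by
    rw [key, mul_comm, Nat.mul_add_mod, Nat.mod_eq_of_lt (by omega)]
  have h2 : T.key m v % (n + 1) = v := by
    rw [key, mul_comm, Nat.mul_add_mod, Nat.mod_eq_of_lt (by omega)]
  rw [← h1, h, h2]

theorem key_le_topKey {u v : ℕ} (h : v ∈ T.kids u) : T.key m v ≤ T.topKey m u :=
  Finset.le_sup (f := T.key m) h

theorem slack_le_of_key_le {u v : ℕ} (hu : u ≤ n) (hv : v ≤ n) (h : T.key m u ≤ T.key m v) :
    T.slack m u ≤ T.slack m v := by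
  rw [← T.key_div m hu, ← T.key_div m hv]
  exact Nat.div_le_div_right h

theorem exists_heavy {v : ℕ} (h : (T.kids v).Nonempty) :
    ∃ c ∈ T.kids v, T.key m c = T.topKey m v := by
  obtain ⟨c, hc, he⟩ := Finset.exists_mem_eq_sup _ h (T.key m)
  exact ⟨c, hc, he.symm⟩

/-- A child that does not attain the largest key; it is placed before the heavy child. -/
def IsLight (v : ℕ) : Prop := T.key m v < T.topKey m (T.par v)

instance : DecidablePred (T.IsLight m) := fun _ => inferInstanceAs (Decidable (_ < _))

theorem extent_le_kidsExtent {u v : ℕ} (h : v ∈ T.kids u) : T.extent m v ≤ T.kidsExtent m u :=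
  Finset.single_le_sum (f := T.extent m) (fun _ _ => Nat.zero_le _) h

theorem width_add_slack {u v : ℕ} (h : v ∈ T.kids u) (hl : ¬ T.IsLight m v) :
    T.width m u + T.slack m v = 1 + T.kidsExtent m u := by
  obtain ⟨⟨h1, h2⟩, rfl⟩ := T.mem_kids.1 h
  have hk : T.key m v = T.topKey m (T.par v) := le_antisymm (T.key_le_topKey m h) (not_lt.1 hl)
  have := T.extent_le_kidsExtent m h
  rw [width_eq, ← hk, T.key_div m h2]
  simp only [extent] at this
  omega

theorem width_pos (v : ℕ) : 0 < T.width m v := by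
  rcases (T.kids v).eq_empty_or_nonempty with h | h
  · rw [width_eq, kidsExtent, topKey, h]
    simp
  · obtain ⟨c, hc, he⟩ := T.exists_heavy m h
    obtain ⟨_, hp⟩ := T.mem_kids.1 hc
    have h1 := T.width_add_slack m hc (by rw [IsLight, hp, he]; exact lt_irrefl _)
    have h2 := T.extent_le_kidsExtent m hc
    simp only [extent] at h2
    omega

/-- The position of a light child `v` relative to that of its parent, minus `1`, is the total
extent of the light children before it; the heavy child comes after all the other children. -/
def offset (v : ℕ) : ℕ :=
  if T.IsLight m v then ∑ c ∈ T.kids (T.par v) with c < v ∧ T.IsLight m c, T.extent m c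
  else T.kidsExtent m (T.par v) - T.extent m v

theorem sum_light_add_extent_le {u h : ℕ} (hh : h ∈ T.kids u) (hl : ¬ T.IsLight m h)
    (s : Finset ℕ) (hs : ∀ c ∈ s, c ∈ T.kids u ∧ T.IsLight m c) :
    ∑ c ∈ s, T.extent m c + T.extent m h ≤ T.kidsExtent m u := by
  have hn : h ∉ s := fun h' => hl (hs h h').2
  rw [add_comm, ← Finset.sum_insert hn]
  refine Finset.sum_le_sum_of_subset fun c hc => ?_
  rcases Finset.mem_insert.1 hc with rfl | hc
  · exact hh
  · exact (hs c hc).1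

theorem offset_add_extent_of_light {v : ℕ} (h1 : 1 ≤ v) (h2 : v ≤ n) (hl : T.IsLight m v) :
    T.offset m v + T.extent m v =
      ∑ c ∈ T.kids (T.par v) with c ≤ v ∧ T.IsLight m c, T.extent m c := by
  have : {c ∈ T.kids (T.par v) | c ≤ v ∧ T.IsLight m c} =
      insert v {c ∈ T.kids (T.par v) | c < v ∧ T.IsLight m c} := by
    ext c
    simp only [Finset.mem_filter, Finset.mem_insert]
    constructor
    · rintro ⟨hk, hle, hc⟩
      rcases hle.eq_or_lt with h | h
      · exact .inl h
      · exact .inr ⟨hk, h, hc⟩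
    · rintro (rfl | h)
      · exact ⟨T.mem_kids_par h1 h2, le_rfl, hl⟩
      · exact ⟨h.1, h.2.1.le, h.2.2⟩
  rw [this, Finset.sum_insert (by simp), offset, if_pos hl, add_comm]

theorem offset_add_extent_of_not_light {v : ℕ} (h1 : 1 ≤ v) (h2 : v ≤ n) (hl : ¬ T.IsLight m v) :
    T.offset m v + T.extent m v = T.kidsExtent m (T.par v) := by
  have := T.extent_le_kidsExtent m (T.mem_kids_par h1 h2)
  rw [offset, if_neg hl]
  omega

theorem offset_light_heavy {u c h : ℕ} (hc : c ∈ T.kids u) (hh : h ∈ T.kids u)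
    (hlc : T.IsLight m c) (hlh : ¬ T.IsLight m h) :
    T.offset m c + T.extent m c ≤ T.offset m h := by
  obtain ⟨⟨h1, h2⟩, hp⟩ := T.mem_kids.1 hc
  obtain ⟨⟨h3, h4⟩, hp'⟩ := T.mem_kids.1 hh
  have := T.sum_light_add_extent_le m hh hlh {x ∈ T.kids u | x ≤ c ∧ T.IsLight m x}
    (fun x hx => by simp only [Finset.mem_filter] at hx; exact ⟨hx.1, hx.2.2⟩)
  rw [← hp, ← T.offset_add_extent_of_light m h1 h2 hlc, hp, ← hp',
    ← T.offset_add_extent_of_not_light m h3 h4 hlh] at this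
  omega

/-- Of two children of the same node, one lies, with its extent, before the other. -/
theorem offset_separated {u c d : ℕ} (hc : c ∈ T.kids u) (hd : d ∈ T.kids u) (hcd : c ≠ d) :
    T.offset m c + T.extent m c ≤ T.offset m d ∨
      T.offset m d + T.extent m d ≤ T.offset m c := by
  have light : ∀ c d, c ∈ T.kids u → d ∈ T.kids u → T.IsLight m c → T.IsLight m d → c < d →
      T.offset m c + T.extent m c ≤ T.offset m d := by
    intro c d hc hd hlc hld hlt
    obtain ⟨⟨h1, h2⟩, hp⟩ := T.mem_kids.1 hc
    obtain ⟨_, hp'⟩ := T.mem_kids.1 hd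
    rw [T.offset_add_extent_of_light m h1 h2 hlc, offset, if_pos hld, hp, hp']
    refine Finset.sum_le_sum_of_subset fun x hx => ?_
    simp only [Finset.mem_filter] at hx ⊢
    exact ⟨hx.1, by omega, hx.2.2⟩
  by_cases hlc : T.IsLight m c <;> by_cases hld : T.IsLight m d
  · rcases Nat.lt_or_gt_of_ne hcd with h | h
    · exact .inl (light c d hc hd hlc hld h)
    · exact .inr (light d c hd hc hld hlc h)
  · exact .inl (T.offset_light_heavy m hc hd hlc hld)
  · exact .inr (T.offset_light_heavy m hd hc hld hlc)
  · -- the keys of distinct nodes differ, so only one child attains the maximum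
    refine absurd (T.key_injOn m (T.mem_kids.1 hc).1.2 (T.mem_kids.1 hd).1.2 ?_) hcd
    have h1 := T.key_le_topKey m hc
    have h2 := T.key_le_topKey m hd
    rw [IsLight, (T.mem_kids.1 hc).2] at hlc
    rw [IsLight, (T.mem_kids.1 hd).2] at hld
    omega

theorem offset_add_width_le {u c : ℕ} (hc : c ∈ T.kids u) :
    1 + T.offset m c + T.width m c ≤ T.width m u := by
  obtain ⟨⟨h1, h2⟩, hp⟩ := T.mem_kids.1 hc
  by_cases hl : T.IsLight m c
  · obtain ⟨h, hh, hk⟩ := T.exists_heavy m ⟨c, hc⟩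
    obtain ⟨⟨h3, h4⟩, hp'⟩ := T.mem_kids.1 hh
    have hlh : ¬ T.IsLight m h := by rw [IsLight, hp', hk]; exact lt_irrefl _
    have e1 := T.offset_light_heavy m hc hh hl hlh
    have e2 := T.width_add_slack m hh hlh
    have e3 := T.offset_add_extent_of_not_light m h3 h4 hlh
    rw [hp'] at e3
    simp only [extent] at *
    omega
  · have e2 := T.width_add_slack m hc hl
    have e3 := T.offset_add_extent_of_not_light m h1 h2 hl
    rw [hp] at e3
    simp only [extent] at *
    omega

/-- The position of a node; the root has position `0`. -/
def pos (v : ℕ) : ℕ :=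
  if h : 1 ≤ v ∧ v ≤ n then pos (T.par v) + 1 + T.offset m v else 0
termination_by T.depth v
decreasing_by exact T.depth_par v h.1 h.2

@[simp] theorem pos_zero : T.pos m 0 = 0 := by rw [pos]; simp

theorem pos_eq {v : ℕ} (h1 : 1 ≤ v) (h2 : v ≤ n) :
    T.pos m v = T.pos m (T.par v) + 1 + T.offset m v := by rw [pos, dif_pos ⟨h1, h2⟩]

theorem pos_of_mem_kids {u v : ℕ} (h : v ∈ T.kids u) :
    T.pos m v = T.pos m u + 1 + T.offset m v := by
  obtain ⟨⟨h1, h2⟩, rfl⟩ := T.mem_kids.1 h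
  exact T.pos_eq m h1 h2

/-- `u` is an ancestor of `v`. -/
def Anc (u v : ℕ) : Prop := Relation.ReflTransGen (fun x y => y ∈ T.kids x) u v

theorem anc_zero {v : ℕ} (hv : v ≤ n) : T.Anc 0 v := by
  refine T.par_induction .refl (fun v h1 h2 ih => ?_) v hv
  exact ih.tail (T.mem_kids_par h1 h2)

theorem Anc.pos_le {u v : ℕ} (h : T.Anc u v) :
    T.pos m u ≤ T.pos m v ∧ T.pos m v + T.width m v ≤ T.pos m u + T.width m u := by
  induction h with
  | refl => simp
  | tail _ h ih =>
    have := T.offset_add_width_le m h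
    rw [T.pos_of_mem_kids m h]
    omega

theorem pos_add_width_le {v : ℕ} (hv : v ≤ n) : T.pos m v + T.width m v ≤ T.width m 0 := by
  simpa using ((T.anc_zero hv).pos_le T m).2

theorem slack_le_of_mem_kids {u v : ℕ} (h : v ∈ T.kids u) : T.slack m v ≤ T.slack m u := by
  have := T.offset_add_width_le m h
  exact Nat.div_le_div_right (by omega)

/-- Only the positions of the nodes below `u` lie within the extent of `u`. The reason is that
the extents of the children of a node are disjoint. -/
theorem anc_of_pos_lt {u v : ℕ} (hu : u ≤ n) (hv : v ≤ n) (h1 : T.pos m u ≤ T.pos m v)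
    (h2 : T.pos m v < T.pos m u + T.extent m u) : T.Anc u v := by
  refine T.par_induction (P := fun u => ∀ v ≤ n, T.pos m u ≤ T.pos m v →
    T.pos m v < T.pos m u + T.extent m u → T.Anc u v) ?_ ?_ u hu v hv h1 h2
  · exact fun v hv _ _ => T.anc_zero hv
  · intro u hu1 hu2 ih v hv h1 h2
    have hk := T.mem_kids_par hu1 hu2
    have e1 := T.pos_of_mem_kids m hk
    have e2 := T.offset_add_width_le m hk
    have e3 := T.slack_le_of_mem_kids m hk
    have e4 : T.Anc (T.par u) v := ih v hv (by omega) (by simp only [extent] at *; omega)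
    rcases Relation.ReflTransGen.cases_head e4 with e | ⟨c, hc, hcv⟩
    · rw [e] at e1
      omega
    · rcases eq_or_ne c u with rfl | hne
      · exact hcv
      · have e5 := Anc.pos_le T m hcv
        have e6 := T.pos_of_mem_kids m hc
        have e7 := T.width_pos m v
        have e8 := T.offset_separated m hc hk hne
        simp only [extent] at *
        omega

/-! ### The width of the root is linear -/

/-- The number of nodes below a node, itself included. -/
def size (v : ℕ) : ℕ := 1 + ∑ c ∈ (T.kids v).attach, size c
termination_by T.height - T.depth v
decreasing_by exact T.height_sub_lt c.2

theorem size_eq (v : ℕ) : T.size v = 1 + ∑ c ∈ T.kids v, T.size c := by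
  rw [size, Finset.sum_attach (T.kids v) T.size]

theorem size_zero : T.size 0 = n + 1 := by
  have h1 : ∑ v ∈ Finset.range (n + 1), T.size v =
      (n + 1) + ∑ v ∈ Finset.Icc 1 n, T.size v := by
    rw [Finset.sum_congr rfl fun v _ => T.size_eq v, Finset.sum_add_distrib]
    congr 1
    · simp
    · exact Finset.sum_fiberwise_of_maps_to (fun v hv => by
        have := Finset.mem_Icc.1 hv
        have := T.par_le v this.1 this.2
        simp; omega) _
  have h2 : Finset.range (n + 1) = insert 0 (Finset.Icc 1 n) := by ext; simp; omega
  rw [h2, Finset.sum_insert (by simp)] at h1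
  omega

theorem size_le {v : ℕ} (hv : v ≤ n) : T.size v ≤ n + 1 := by
  refine T.par_induction T.size_zero.le (fun v h1 h2 ih => le_trans ?_ ih) v hv
  rw [T.size_eq (T.par v)]
  have := Finset.single_le_sum (f := T.size) (fun _ _ => Nat.zero_le _) (T.mem_kids_par h1 h2)
  omega

/-- A width exceeds the size by a factor of at most `1 + 2 log₂ (width) / 2 ^ m`, and this factor
is at most `2`. The logarithm bounds the number of light nodes on the path from the root: the
width of a light child is at most half of that of its parent. -/
theorem width_bounds (L : ℕ) (hL : n + 1 ≤ 2 ^ L) (hm : 2 * (L + 2) ≤ 2 ^ m) {v : ℕ}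
    (hv : v ≤ n) : T.width m v ≤ 2 * T.size v ∧
      T.width m v * 2 ^ m ≤ T.size v * (2 ^ m + 2 * Nat.log 2 (T.width m v)) := by
  refine T.kids_induction (P := fun v => v ≤ n → T.width m v ≤ 2 * T.size v ∧
      T.width m v * 2 ^ m ≤ T.size v * (2 ^ m + 2 * Nat.log 2 (T.width m v))) ?_ v hv
  intro v ih hv
  have ih' : ∀ c ∈ T.kids v, _ := fun c hc => ih c hc (T.mem_kids.1 hc).1.2
  suffices h : T.width m v * 2 ^ m ≤ T.size v * (2 ^ m + 2 * Nat.log 2 (T.width m v)) by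
    refine ⟨?_, h⟩
    have h4 : T.width m v ≤ 4 * T.size v := by
      have : T.kidsExtent m v ≤ ∑ c ∈ T.kids v, 4 * T.size c := by
        refine Finset.sum_le_sum fun c hc => ?_
        have := (ih' c hc).1
        have : T.slack m c ≤ T.width m c := Nat.div_le_self _ _
        rw [extent]
        omega
      rw [← Finset.mul_sum] at this
      rw [width_eq, size_eq]
      have := Nat.sub_le (1 + T.kidsExtent m v) (T.topKey m v / (n + 1))
      omega
    have hlog : Nat.log 2 (T.width m v) ≤ L + 2 := by
      refine (Nat.log_mono_right
        (h4.trans (Nat.mul_le_mul_left 4 ((T.size_le hv).trans hL)))).trans ?_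
      rw [show 4 * 2 ^ L = 2 ^ (L + 2) by ring, Nat.log_pow (by norm_num)]
    have hpos : 0 < 2 ^ m := by positivity
    refine Nat.le_of_mul_le_mul_right (h.trans ?_) hpos
    calc T.size v * (2 ^ m + 2 * Nat.log 2 (T.width m v))
        ≤ T.size v * (2 ^ m + 2 ^ m) := by gcongr; omega
      _ = 2 * T.size v * 2 ^ m := by ring
  set l := Nat.log 2 (T.width m v) with hl
  have hmono : ∀ c ∈ T.kids v, T.width m c * 2 ^ m ≤ T.size c * (2 ^ m + 2 * l) := by
    intro c hc
    refine (ih' c hc).2.trans ?_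
    have := T.offset_add_width_le m hc
    have : Nat.log 2 (T.width m c) ≤ l := Nat.log_mono_right (by omega)
    gcongr
  rcases (T.kids v).eq_empty_or_nonempty with h0 | h0
  · rw [width_eq, size_eq, kidsExtent, topKey, h0]
    simp
  obtain ⟨h, hh, hk⟩ := T.exists_heavy m h0
  obtain ⟨⟨-, hhn⟩, hp⟩ := T.mem_kids.1 hh
  have hlh : ¬ T.IsLight m h := by rw [IsLight, hp, hk]; exact lt_irrefl _
  -- a child of maximal width has the same slack as the heavy child
  obtain ⟨d, hd, hmax⟩ := Finset.exists_max_image (T.kids v) (T.width m) h0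
  have hslack : T.slack m d = T.slack m h := by
    refine le_antisymm ?_ (Nat.div_le_div_right (hmax h hh))
    exact T.slack_le_of_key_le m (T.mem_kids.1 hd).1.2 hhn (hk ▸ T.key_le_topKey m hd)
  have hw : T.width m v = 1 + T.width m d + ∑ c ∈ (T.kids v).erase d, T.extent m c := by
    have e1 := T.width_add_slack m hh hlh
    rw [kidsExtent, ← Finset.add_sum_erase _ _ hd, ← hslack, extent] at e1
    omega
  have hs : T.size v = 1 + T.size d + ∑ c ∈ (T.kids v).erase d, T.size c := by
    rw [size_eq, ← Finset.add_sum_erase _ _ hd, add_assoc]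
  have hlight : ∀ c ∈ (T.kids v).erase d,
      T.extent m c * 2 ^ m ≤ T.size c * (2 ^ m + 2 * l) := by
    intro c hc
    have hck := Finset.mem_of_mem_erase hc
    have e1 : T.extent m c ≤ ∑ c ∈ (T.kids v).erase d, T.extent m c :=
      Finset.single_le_sum (f := T.extent m) (fun _ _ => Nat.zero_le _) hc
    have e2 := hmax c hck
    have e3 : Nat.log 2 (T.width m c) + 1 ≤ l := by
      rw [← Nat.log_mul_base (by norm_num) (T.width_pos m c).ne']
      refine Nat.log_mono_right ?_
      rw [extent] at e1
      omega
    have e4 : T.slack m c * 2 ^ m ≤ T.width m c := Nat.div_mul_le_self _ _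
    obtain ⟨e5, e6⟩ := ih' c hck
    calc T.extent m c * 2 ^ m = T.width m c * 2 ^ m + T.slack m c * 2 ^ m := by
          rw [extent, add_mul]
      _ ≤ T.size c * (2 ^ m + 2 * Nat.log 2 (T.width m c)) + 2 * T.size c := by omega
      _ = T.size c * (2 ^ m + 2 * (Nat.log 2 (T.width m c) + 1)) := by ring
      _ ≤ T.size c * (2 ^ m + 2 * l) := by gcongr
  calc T.width m v * 2 ^ m
      = 2 ^ m + T.width m d * 2 ^ m + ∑ c ∈ (T.kids v).erase d, T.extent m c * 2 ^ m := by
        rw [hw, add_mul, add_mul, one_mul, Finset.sum_mul]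
    _ ≤ (2 ^ m + 2 * l) + T.size d * (2 ^ m + 2 * l) +
          ∑ c ∈ (T.kids v).erase d, T.size c * (2 ^ m + 2 * l) :=
        add_le_add (add_le_add (by omega) (hmono d hd)) (Finset.sum_le_sum hlight)
    _ = T.size v * (2 ^ m + 2 * l) := by rw [hs, add_mul, add_mul, one_mul, Finset.sum_mul]

theorem width_le (L : ℕ) (hL : n + 1 ≤ 2 ^ L) (hm : 2 * (L + 2) ≤ 2 ^ m) {v : ℕ} (hv : v ≤ n) :
    T.width m v ≤ 2 * (n + 1) :=
  (T.width_bounds m L hL hm hv).1.trans (Nat.mul_le_mul_left 2 (T.size_le hv))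

end ParentTree

/-! ### Labels -/

/-- The number of bits used for the exponent of a rounded width in a label of an `n`-node forest;
it is `log log n + O(1)`. -/
def expBits (n : ℕ) : ℕ := Nat.size (2 * Nat.size n + 4)

theorem two_mul_size_lt (n : ℕ) : 2 * Nat.size n + 4 < 2 ^ expBits n := Nat.lt_size_self _

/-- The length of the labels of an `n`-node forest. -/
def labelLength (n : ℕ) : ℕ := 3 * expBits n + 2 + (Nat.size n + 1)

/-- The exponent of the width `x`, rounded to `m + 1` significant bits. -/
def roundExp (m x : ℕ) : ℕ := Nat.size (x / 2 ^ m / 2)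

/-- The mantissa of the width `x`, rounded up to `m + 1` significant bits, minus `1`. -/
def roundMant (m x : ℕ) : ℕ := (x - 1) / 2 ^ roundExp m x

theorem le_rounded (m x : ℕ) : x ≤ (roundMant m x + 1) * 2 ^ roundExp m x := by
  have := Nat.lt_mul_div_succ (x - 1) (b := 2 ^ roundExp m x) (by positivity)
  rw [roundMant, mul_comm]
  omega

/-- Rounding up adds at most `x / 2 ^ m`. -/
theorem rounded_le (m : ℕ) {x : ℕ} (hx : 0 < x) :
    (roundMant m x + 1) * 2 ^ roundExp m x ≤ x + x / 2 ^ m := by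
  have h1 := Nat.div_mul_le_self (x - 1) (2 ^ roundExp m x)
  have h2 : 2 ^ roundExp m x ≤ x / 2 ^ m + 1 := by
    rw [roundExp]
    generalize x / 2 ^ m = q
    rcases Nat.eq_zero_or_pos (Nat.size (q / 2)) with h | h
    · rw [h]; omega
    · have := Nat.lt_size.1 (Nat.sub_lt h one_pos)
      have e : 2 ^ Nat.size (q / 2) = 2 * 2 ^ (Nat.size (q / 2) - 1) := by
        rw [← pow_succ']
        congr 1
        omega
      omega
  rw [roundMant, add_mul]
  generalize x / 2 ^ m = q at h2 ⊢
  omega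

theorem roundMant_lt (m x : ℕ) : roundMant m x < 2 ^ (m + 1) := by
  rw [roundMant, Nat.div_lt_iff_lt_mul (by positivity)]
  have h1 : x / 2 ^ m / 2 < 2 ^ roundExp m x := Nat.lt_size_self _
  rw [Nat.div_div_eq_div_mul, ← pow_succ, Nat.div_lt_iff_lt_mul (by positivity)] at h1
  rw [mul_comm]
  omega

/-- The bits of a label: `m` in unary, `m` bits for the exponent and `m + 1` bits for the mantissa
of a rounded width, and a position. -/
def packLabel (m e x a : ℕ) : ℕ := 2 ^ m + 2 ^ (m + 1) * (e + 2 ^ m * (x + 2 ^ (m + 1) * a))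

theorem padicValNat_packLabel (m e x a : ℕ) : padicValNat 2 (packLabel m e x a) = m := by
  have : packLabel m e x a = 2 ^ m * (1 + 2 * (e + 2 ^ m * (x + 2 ^ (m + 1) * a))) := by
    rw [packLabel]; ring
  rw [this, padicValNat.mul (by positivity) (by omega), padicValNat.prime_pow,
    padicValNat.eq_zero_of_not_dvd (by omega), add_zero]

theorem packLabel_div (m e x a : ℕ) :
    packLabel m e x a / 2 ^ (m + 1) = e + 2 ^ m * (x + 2 ^ (m + 1) * a) := by
  rw [packLabel, Nat.add_mul_div_left _ _ (by positivity),
    Nat.div_eq_of_lt (Nat.pow_lt_pow_right (by norm_num) (by omega)), zero_add]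

theorem packLabel_div_pos {m e x : ℕ} (he : e < 2 ^ m) (hx : x < 2 ^ (m + 1)) (a : ℕ) :
    packLabel m e x a / 2 ^ (3 * m + 2) = a := by
  have : 3 * m + 2 = (m + 1) + m + (m + 1) := by ring
  rw [this, pow_add, pow_add, ← Nat.div_div_eq_div_mul, ← Nat.div_div_eq_div_mul, packLabel_div,
    Nat.add_mul_div_left _ _ (by positivity), Nat.div_eq_of_lt he, zero_add,
    Nat.add_mul_div_left _ _ (by positivity), Nat.div_eq_of_lt hx, zero_add]

theorem add_mul_lt {a b k l : ℕ} (ha : a < 2 ^ k) (hb : b < 2 ^ l) :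
    a + 2 ^ k * b < 2 ^ (k + l) := by
  have : 2 ^ k * (b + 1) ≤ 2 ^ k * 2 ^ l := Nat.mul_le_mul_left _ hb
  rw [pow_add]
  rw [mul_add] at this
  omega

theorem packLabel_lt {m e x a k : ℕ} (he : e < 2 ^ m) (hx : x < 2 ^ (m + 1)) (ha : a < 2 ^ k) :
    packLabel m e x a < 2 ^ (3 * m + 2 + k) := by
  have := add_mul_lt (k := m + 1) (Nat.pow_lt_pow_right one_lt_two (Nat.lt_succ_self m))
    (add_mul_lt he (add_mul_lt hx ha))
  rw [packLabel, show 3 * m + 2 + k = m + 1 + (m + (m + 1 + k)) by ring]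
  exact this

/-- The `k` lowest bits of `x`, the least significant one first. -/
def lowBits : ℕ → ℕ → List Bool
  | 0, _ => []
  | k + 1, x => decide (x % 2 = 1) :: lowBits k (x / 2)

@[simp] theorem length_lowBits (k x : ℕ) : (lowBits k x).length = k := by
  induction k generalizing x with
  | zero => rfl
  | succ k ih => simp [lowBits, ih]

theorem bitsValue_lowBits {k x : ℕ} (h : x < 2 ^ k) : WordRAM.bitsValue (lowBits k x) = x := by
  induction k generalizing x with
  | zero => simp at h; simp [lowBits, WordRAM.bitsValue, h]
  | succ k ih =>
    rw [lowBits, WordRAM.bitsValue, ih (by rw [pow_succ] at h; omega)]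
    rcases Nat.mod_two_eq_zero_or_one x with h | h <;> simp [h] <;> omega

/-! ### The tree of a forest -/

/-- The number of the parent of a node of a forest, in the numbering `1, …, n`; `0` for a root. -/
def RootedForest.parentCode {n : ℕ} (F : RootedForest n) (v : Fin n) : ℕ :=
  match F.parent v with
  | none => 0
  | some u => (u : ℕ) + 1

/-- The number of ancestors of a node. -/
noncomputable def RootedForest.depth {n : ℕ} (F : RootedForest n) : Fin n → ℕ :=
  F.acyclic.fix fun v d => 1 + ∑ u, if h : F.parent v = some u then d u h else 0

theorem RootedForest.depth_eq {n : ℕ} (F : RootedForest n) (v : Fin n) :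
    F.depth v = 1 + ∑ u, if F.parent v = some u then F.depth u else 0 := by
  rw [depth, WellFounded.fix_eq]
  simp

/-- The tree obtained from a forest by attaching its roots to an extra node `0`. -/
noncomputable def RootedForest.tree {n : ℕ} (F : RootedForest n) : ParentTree n where
  par v := if h : v - 1 < n then F.parentCode ⟨v - 1, h⟩ else 0
  depth v := if h : 1 ≤ v ∧ v - 1 < n then F.depth ⟨v - 1, h.2⟩ else 0
  par_le v h1 h2 := by
    rw [dif_pos (by omega), parentCode]
    split <;> omega
  depth_par v h1 h2 := by
    have h : v - 1 < n := by omega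
    have hd := F.depth_eq ⟨v - 1, h⟩
    rw [dif_pos (⟨h1, h⟩ : 1 ≤ v ∧ v - 1 < n)]
    simp only [dif_pos h]
    cases hp : F.parent ⟨v - 1, h⟩ with
    | none =>
      have : F.parentCode ⟨v - 1, h⟩ = 0 := by simp [parentCode, hp]
      rw [dif_neg (by omega)]
      omega
    | some u =>
      have hc : F.parentCode ⟨v - 1, h⟩ = u + 1 := by simp [parentCode, hp]
      have := Finset.single_le_sum (f := fun u' => if F.parent ⟨v - 1, h⟩ = some u'
        then F.depth u' else 0) (fun _ _ => Nat.zero_le _) (Finset.mem_univ u)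
      rw [if_pos hp] at this
      simp only [hc, Nat.add_sub_cancel]
      rw [dif_pos ⟨by omega, u.2⟩]
      exact lt_of_le_of_lt this (by omega)

theorem RootedForest.tree_par {n : ℕ} (F : RootedForest n) (v : Fin n) :
    F.tree.par (v + 1) = F.parentCode v := by
  simp [tree]

theorem RootedForest.succ_mem_kids {n : ℕ} (F : RootedForest n) (u v : Fin n) :
    (v + 1 : ℕ) ∈ F.tree.kids (u + 1) ↔ F.parent v = some u := by
  rw [ParentTree.mem_kids, tree_par, parentCode]
  split
  · rename_i h; simp [h]
  · rename_i x h
    simp only [h, Option.some.injEq, Fin.ext_iff]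
    omega

theorem RootedForest.anc_iff {n : ℕ} (F : RootedForest n) (u v : Fin n) :
    F.tree.Anc (u + 1) (v + 1) ↔ F.IsAncestor u v := by
  constructor
  · intro h
    have : ∀ x y, F.tree.Anc x y → ∀ u : Fin n, x = u + 1 → ∃ v : Fin n, y = v + 1 ∧
        F.IsAncestor u v := by
      intro x y h u hu
      induction h with
      | refl => exact ⟨u, hu, .refl⟩
      | tail _ h ih =>
        obtain ⟨v, rfl, hv⟩ := ih
        obtain ⟨⟨h1, h2⟩, -⟩ := F.tree.mem_kids.1 h
        rename_i c _
        obtain ⟨c, rfl⟩ : ∃ i : Fin n, c = i + 1 := ⟨⟨c - 1, by omega⟩, by simp; omega⟩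
        exact ⟨c, rfl, hv.tail ((F.succ_mem_kids _ _).1 h)⟩
    obtain ⟨v', e, h'⟩ := this _ _ h u rfl
    obtain rfl : v = v' := by ext; omega
    exact h'
  · intro h
    induction h with
    | refl => exact .refl
    | tail _ h ih => exact ih.tail ((F.succ_mem_kids _ _).2 h)

/-! ### The labeling scheme -/

namespace ParentTree

variable {n : ℕ} (T : ParentTree n)

/-- The label of node `v`, as a number. -/
def labelValue (v : ℕ) : ℕ :=
  packLabel (expBits n) (roundExp (expBits n) (T.width (expBits n) v))
    (roundMant (expBits n) (T.width (expBits n) v)) (T.pos (expBits n) v)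

theorem width_le' {v : ℕ} (hv : v ≤ n) : T.width (expBits n) v ≤ 2 * (n + 1) :=
  T.width_le _ (Nat.size n) (Nat.lt_size_self n) (by have := two_mul_size_lt n; omega) hv

theorem pos_lt {v : ℕ} (hv : v ≤ n) : T.pos (expBits n) v < 2 ^ (Nat.size n + 1) := by
  have h1 := T.pos_add_width_le (expBits n) hv
  have h2 := T.width_pos (expBits n) v
  have h3 := T.width_le' (Nat.zero_le n)
  have h4 := Nat.lt_size_self n
  rw [pow_succ]
  omega

theorem roundExp_lt {v : ℕ} (hv : v ≤ n) :
    roundExp (expBits n) (T.width (expBits n) v) < 2 ^ expBits n := by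
  have h1 : roundExp (expBits n) (T.width (expBits n) v) ≤ Nat.size n + 2 := by
    rw [roundExp, Nat.size_le]
    have h3 := T.width_le' hv
    have h4 := Nat.lt_size_self n
    rw [pow_succ, pow_succ]
    refine lt_of_le_of_lt ((Nat.div_le_self _ _).trans (Nat.div_le_self _ _)) ?_
    omega
  have := two_mul_size_lt n
  omega

theorem labelValue_lt {v : ℕ} (hv : v ≤ n) :
    T.labelValue v < 2 ^ labelLength n :=
  packLabel_lt (T.roundExp_lt hv) (roundMant_lt _ _) (T.pos_lt hv)

end ParentTree

/-- The end, exclusive, of the block of positions that a label claims: its position plus its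
rounded width. -/
def blockEnd (X : ℕ) : ℕ :=
  let m := padicValNat 2 X
  let y := X / 2 ^ (m + 1)
  let z := y / 2 ^ m
  z / 2 ^ (m + 1) + (z % 2 ^ (m + 1) + 1) * 2 ^ (y % 2 ^ m)

/-- The position stored in a label. -/
def labelPos (X : ℕ) : ℕ := X / 2 ^ (3 * padicValNat 2 X + 2)

theorem labelPos_packLabel {m e x : ℕ} (he : e < 2 ^ m) (hx : x < 2 ^ (m + 1)) (a : ℕ) :
    labelPos (packLabel m e x a) = a := by
  rw [labelPos, padicValNat_packLabel, packLabel_div_pos he hx]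

theorem blockEnd_packLabel {m e x : ℕ} (he : e < 2 ^ m) (hx : x < 2 ^ (m + 1)) (a : ℕ) :
    blockEnd (packLabel m e x a) = a + (x + 1) * 2 ^ e := by
  have h1 : (e + 2 ^ m * (x + 2 ^ (m + 1) * a)) / 2 ^ m = x + 2 ^ (m + 1) * a := by
    rw [Nat.add_mul_div_left _ _ (by positivity), Nat.div_eq_of_lt he, zero_add]
  have h2 : (e + 2 ^ m * (x + 2 ^ (m + 1) * a)) % 2 ^ m = e := by
    rw [Nat.add_mul_mod_self_left, Nat.mod_eq_of_lt he]
  simp only [blockEnd, padicValNat_packLabel, packLabel_div, h1, h2]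
  rw [Nat.add_mul_div_left _ _ (by positivity), Nat.div_eq_of_lt hx, zero_add,
    Nat.add_mul_mod_self_left, Nat.mod_eq_of_lt hx]

theorem ParentTree.labelPos_labelValue {n : ℕ} (T : ParentTree n) {v : ℕ} (hv : v ≤ n) :
    labelPos (T.labelValue v) = T.pos (expBits n) v :=
  labelPos_packLabel (T.roundExp_lt hv) (roundMant_lt _ _) _

theorem ParentTree.le_blockEnd {n : ℕ} (T : ParentTree n) {v : ℕ} (hv : v ≤ n) :
    T.pos (expBits n) v + T.width (expBits n) v ≤ blockEnd (T.labelValue v) := by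
  rw [labelValue, blockEnd_packLabel (T.roundExp_lt hv) (roundMant_lt _ _)]
  exact Nat.add_le_add_left (le_rounded _ _) _

theorem ParentTree.blockEnd_le {n : ℕ} (T : ParentTree n) {v : ℕ} (hv : v ≤ n) :
    blockEnd (T.labelValue v) ≤ T.pos (expBits n) v + T.extent (expBits n) v := by
  rw [labelValue, blockEnd_packLabel (T.roundExp_lt hv) (roundMant_lt _ _)]
  exact Nat.add_le_add_left (rounded_le _ (T.width_pos _ _)) _

/-- The labeling scheme: a node is an ancestor of another one if its block contains the position
of the latter. -/
noncomputable def intervalScheme : AncestryLabelingScheme where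
  label {n} F v := lowBits (labelLength n) (F.tree.labelValue (v + 1))
  decode l₁ l₂ :=
    decide (labelPos (WordRAM.bitsValue l₁) ≤ labelPos (WordRAM.bitsValue l₂)) &&
      decide (labelPos (WordRAM.bitsValue l₂) < blockEnd (WordRAM.bitsValue l₁))
  correct {n} F u v := by
    have hu : (u + 1 : ℕ) ≤ n := u.2
    have hv : (v + 1 : ℕ) ≤ n := v.2
    rw [bitsValue_lowBits (F.tree.labelValue_lt hu), bitsValue_lowBits (F.tree.labelValue_lt hv),
      F.tree.labelPos_labelValue hu, F.tree.labelPos_labelValue hv, ← F.anc_iff,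
      Bool.and_eq_true, decide_eq_true_iff, decide_eq_true_iff]
    constructor
    · rintro ⟨h1, h2⟩
      exact F.tree.anc_of_pos_lt _ hu hv h1 (h2.trans_le (F.tree.blockEnd_le hu))
    · intro h
      obtain ⟨h1, h2⟩ := ParentTree.Anc.pos_le _ (expBits n) h
      have h3 := F.tree.le_blockEnd hu
      have h4 := F.tree.width_pos (expBits n) (v + 1)
      exact ⟨h1, by omega⟩

theorem bitsValue_label {n : ℕ} (F : RootedForest n) (v : Fin n) :
    WordRAM.bitsValue (intervalScheme.label F v) = F.tree.labelValue (v + 1) :=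
  bitsValue_lowBits (F.tree.labelValue_lt v.2)

theorem length_label {n : ℕ} (F : RootedForest n) (v : Fin n) :
    (intervalScheme.label F v).length = labelLength n :=
  length_lowBits _ _

namespace WordRAM

open WordRAM.Expr

/-! ### The query program -/

instance : Add Expr := ⟨.op .add⟩
instance : Sub Expr := ⟨.op .sub⟩
instance : Mul Expr := ⟨.op .mul⟩
instance : Div Expr := ⟨.op .div⟩
instance : ShiftLeft Expr := ⟨.op .shl⟩
instance : ShiftRight Expr := ⟨.op .shr⟩
instance (c : ℕ) : OfNat Expr c := ⟨.const c⟩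

section Eval

variable {w : ℕ} {s : State} {e₁ e₂ e : Expr} {x y : ℕ}

theorem eval_const {c : ℕ} (h : (OfNat.ofNat c : ℕ) < 2 ^ w) :
    (OfNat.ofNat c : Expr).eval w s = (OfNat.ofNat c : ℕ) :=
  Nat.mod_eq_of_lt h

theorem eval_reg {r : ℕ} (h : s.reg r = x) : (Expr.reg r).eval w s = x := h

theorem eval_load {a : ℕ} (h : e.eval w s = x) (hy : s.arr a x = y) :
    (Expr.load a e).eval w s = y := by rw [Expr.eval, h, hy]

theorem eval_add (h₁ : e₁.eval w s = x) (h₂ : e₂.eval w s = y) (h : x + y < 2 ^ w) :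
    (e₁ + e₂).eval w s = x + y := by
  subst h₁ h₂
  exact Nat.mod_eq_of_lt h

theorem eval_sub (h₁ : e₁.eval w s = x) (h₂ : e₂.eval w s = y) :
    (e₁ - e₂).eval w s = x - y := by
  subst h₁ h₂
  rfl

theorem eval_mul (h₁ : e₁.eval w s = x) (h₂ : e₂.eval w s = y) (h : x * y < 2 ^ w) :
    (e₁ * e₂).eval w s = x * y := by
  subst h₁ h₂
  exact Nat.mod_eq_of_lt h

theorem eval_div (h₁ : e₁.eval w s = x) (h₂ : e₂.eval w s = y) :
    (e₁ / e₂).eval w s = x / y := by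
  subst h₁ h₂
  rfl

theorem eval_shl (h₁ : e₁.eval w s = x) (h₂ : e₂.eval w s = y) (h : x * 2 ^ y < 2 ^ w) :
    (e₁ <<< e₂).eval w s = x * 2 ^ y := by
  subst h₁ h₂
  exact Nat.mod_eq_of_lt h

theorem eval_shr (h₁ : e₁.eval w s = x) (h₂ : e₂.eval w s = y) :
    (e₁ >>> e₂).eval w s = x / 2 ^ y := by
  subst h₁ h₂
  rfl

theorem eval_lt (h₁ : e₁.eval w s = x) (h₂ : e₂.eval w s = y) (hw : 0 < w) :
    (Expr.op .lt e₁ e₂).eval w s = (decide (x < y)).toNat := by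
  subst h₁ h₂
  have : 1 % 2 ^ w = 1 := Nat.mod_eq_of_lt (Nat.one_lt_two_pow hw.ne')
  by_cases h : e₁.eval w s < e₂.eval w s <;> simp [Expr.eval, Op.eval, h, this]

theorem eval_lsb (h : e.eval w s = x) : (Expr.lsb e).eval w s = padicValNat 2 x := by
  rw [Expr.eval, h]

end Eval

/-- The query program: registers `4` to `9` receive `m`, the label without its `m + 1` lowest bits,
this number without the exponent, the exponent, the position, and the mantissa of the first label;
registers `10` and `11` receive `m` and the position of the second one. -/
def queryProgram : Program :=
  .seq (.assign 4 (lsb (reg 1))) <|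
  .seq (.assign 5 (reg 1 >>> (reg 4 + 1))) <|
  .seq (.assign 6 (reg 5 >>> reg 4)) <|
  .seq (.assign 7 (reg 5 - reg 6 <<< reg 4)) <|
  .seq (.assign 8 (reg 6 >>> (reg 4 + 1))) <|
  .seq (.assign 9 (reg 6 - reg 8 <<< (reg 4 + 1))) <|
  .seq (.assign 10 (lsb (reg 3))) <|
  .seq (.assign 11 (reg 3 >>> (3 * reg 10 + 2))) <|
  .assign 0 ((1 - op .lt (reg 11) (reg 8)) * op .lt (reg 11) (reg 8 + (reg 9 + 1) <<< reg 7))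

theorem queryProgram_runs {w : ℕ} {s : State} {X Y : ℕ} (hX : s.reg 1 = X) (hY : s.reg 3 = Y)
    (hXw : X < 2 ^ w) (hb : blockEnd X < 2 ^ w) (hm : 3 * padicValNat 2 X + 3 < 2 ^ w)
    (hm' : 3 * padicValNat 2 Y + 2 < 2 ^ w) :
    Runs w queryProgram s 100 fun s' => s'.reg 0 =
      (decide (labelPos X ≤ labelPos Y) && decide (labelPos Y < blockEnd X)).toNat := by
  -- both ways of reading the position, as in `labelPos` and as in `blockEnd`, agree
  have hpos : labelPos X = X / 2 ^ (padicValNat 2 X + 1) / 2 ^ padicValNat 2 X /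
      2 ^ (padicValNat 2 X + 1) := by
    rw [Nat.div_div_eq_div_mul, Nat.div_div_eq_div_mul, ← pow_add, ← pow_add, labelPos]
    congr 2
    ring
  have hw : 0 < w := Nat.pos_of_ne_zero fun h => by subst h; simp at hm
  simp only [blockEnd] at hb
  rw [blockEnd, hpos, labelPos]
  generalize hm1 : padicValNat 2 X = m at *
  generalize hm0 : padicValNat 2 Y = m' at *
  generalize hy : X / 2 ^ (m + 1) = y at *
  generalize hz : y / 2 ^ m = z at *
  generalize ha : z / 2 ^ (m + 1) = a at *
  have hyX : y ≤ X := hy ▸ Nat.div_le_self _ _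
  have hzy : z * 2 ^ m ≤ y := hz ▸ Nat.div_mul_le_self _ _
  have hzy' : z ≤ y := hz ▸ Nat.div_le_self _ _
  have haz : a * 2 ^ (m + 1) ≤ z := ha ▸ Nat.div_mul_le_self _ _
  have hye : y % 2 ^ m = y - z * 2 ^ m := by rw [Nat.mod_eq_sub_div_mul, hz]
  have hzx : z % 2 ^ (m + 1) = z - a * 2 ^ (m + 1) := by rw [Nat.mod_eq_sub_div_mul, ha]
  rw [hye, hzx] at hb
  rw [hye, hzx]
  have hx1 : z - a * 2 ^ (m + 1) + 1 ≤ (z - a * 2 ^ (m + 1) + 1) * 2 ^ (y - z * 2 ^ m) :=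
    Nat.le_mul_of_pos_right _ (by positivity)
  have h1 : m + 1 < 2 ^ w := by omega
  refine Computes.runs (T := 100) ?_ (by decide)
  refine .seq_assign m (eval_lsb (eval_reg hX) |>.trans hm1) ?_
  refine .seq_assign y (eval_shr (eval_reg (by simpa)) (eval_add (eval_reg (by simp))
    (eval_const (by omega)) h1) |>.trans hy) ?_
  refine .seq_assign z (eval_shr (eval_reg (by simp)) (eval_reg (by simp)) |>.trans hz) ?_
  refine .seq_assign (y - z * 2 ^ m) (eval_sub (eval_reg (by simp)) (eval_shl (eval_reg (by simp))
    (eval_reg (by simp)) (by omega))) ?_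
  refine .seq_assign a (eval_shr (eval_reg (by simp)) (eval_add (eval_reg (by simp))
    (eval_const (by omega)) h1) |>.trans ha) ?_
  refine .seq_assign (z - a * 2 ^ (m + 1)) (eval_sub (eval_reg (by simp)) (eval_shl
    (eval_reg (by simp)) (eval_add (eval_reg (by simp)) (eval_const (by omega)) h1) (by omega))) ?_
  refine .seq_assign m' (eval_lsb (eval_reg (by simpa)) |>.trans hm0) ?_
  refine .seq_assign (Y / 2 ^ (3 * m' + 2)) (eval_shr (eval_reg (by simpa)) (eval_add
    (eval_mul (eval_const (by omega)) (eval_reg (by simp)) (by omega)) (eval_const (by omega))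
    (by omega))) ?_
  refine .assign _ (eval_mul (eval_sub (eval_const (by omega)) (eval_lt (eval_reg (by simp; rfl))
    (eval_reg (by simp; rfl)) hw)) (eval_lt (eval_reg (by simp; rfl)) (eval_add
    (eval_reg (by simp)) (eval_shl (eval_add (eval_reg (by simp)) (eval_const (by omega))
    (by omega)) (eval_reg (by simp)) (by omega)) hb) hw) ?_) ?_
  · have : 1 < 2 ^ w := by omega
    rcases decide _ <;> rcases decide _ <;> simp [this]
  · simp only [State.setReg_reg, if_true, ← not_lt, decide_not]
    rcases decide _ <;> rcases decide _ <;> rfl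

end WordRAM

/-! ### Queueing the nodes, children before parents -/

namespace ParentTree

variable {n : ℕ} (T : ParentTree n)

/-- `Q 0, …, Q (n - 1)` lists the nodes other than the root, children before parents. -/
structure IsPostorder (Q : ℕ → ℕ) : Prop where
  image : (Finset.range n).image Q = Finset.Icc 1 n
  kids_subset : ∀ j < n, T.kids (Q j) ⊆ (Finset.range j).image Q

/-- The state of a queue `Q` with `t` entries, of which `k` have been taken out: it has received
the nodes all of whose children have been taken out, and `deg u` counts the children of `u` that
have not been taken out. -/
structure IsQueue (Q deg : ℕ → ℕ) (k t : ℕ) : Prop where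
  card : ((Finset.range t).image Q).card = t
  le : k ≤ t
  mem : ∀ v, v ∈ (Finset.range t).image Q ↔
    (1 ≤ v ∧ v ≤ n) ∧ T.kids v ⊆ (Finset.range k).image Q
  kids_subset : ∀ j < k, T.kids (Q j) ⊆ (Finset.range j).image Q
  deg_eq : ∀ u ≤ n, deg u = (T.kids u \ (Finset.range k).image Q).card

variable {T} {Q deg : ℕ → ℕ} {k t : ℕ}

namespace IsQueue

theorem injOn (h : T.IsQueue Q deg k t) : Set.InjOn Q (Finset.range t) :=
  Finset.card_image_iff.1 (by rw [h.card, Finset.card_range])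

theorem subset (h : T.IsQueue Q deg k t) :
    (Finset.range t).image Q ⊆ Finset.Icc 1 n := fun v hv =>
  Finset.mem_Icc.2 ((h.mem v).1 hv).1

/-- The queue is not empty before all nodes have been taken out: the deepest remaining node has no
remaining children. -/
theorem lt (h : T.IsQueue Q deg k t) (hk : k < n) : k < t := by
  refine h.le.lt_of_ne fun e => ?_
  subst e
  obtain ⟨v, hv⟩ : (Finset.Icc 1 n \ (Finset.range k).image Q).Nonempty := by
    rw [← Finset.card_pos]
    have := Finset.le_card_sdiff ((Finset.range k).image Q) (Finset.Icc 1 n)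
    rw [h.card, Nat.card_Icc] at this
    omega
  obtain ⟨v, hv, hmax⟩ := Finset.exists_max_image _ T.depth ⟨v, hv⟩
  rw [Finset.mem_sdiff, Finset.mem_Icc] at hv
  refine hv.2 ((h.mem v).2 ⟨hv.1, fun c hc => ?_⟩)
  by_contra hcD
  obtain ⟨⟨h1, h2⟩, hp⟩ := T.mem_kids.1 hc
  have h3 := hmax c (Finset.mem_sdiff.2 ⟨Finset.mem_Icc.2 ⟨h1, h2⟩, hcD⟩)
  have h4 := T.depth_par c h1 h2
  rw [hp] at h4
  omega

theorem bounds (h : T.IsQueue Q deg k t) {j : ℕ} (hj : j < t) : 1 ≤ Q j ∧ Q j ≤ n :=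
  ((h.mem _).1 (Finset.mem_image_of_mem _ (Finset.mem_range.2 hj))).1

theorem notMem (h : T.IsQueue Q deg k t) (hk : k < t) : Q k ∉ (Finset.range k).image Q := by
  intro hc
  obtain ⟨j, hj, e⟩ := Finset.mem_image.1 hc
  have := Finset.mem_range.1 hj
  have := h.injOn (by simp; omega) (by simpa using hk) e
  omega

theorem kids_subset_head (h : T.IsQueue Q deg k t) (hk : k < t) :
    T.kids (Q k) ⊆ (Finset.range k).image Q :=
  ((h.mem _).1 (Finset.mem_image_of_mem _ (Finset.mem_range.2 hk))).2

theorem image_succ (Q : ℕ → ℕ) (k : ℕ) :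
    (Finset.range (k + 1)).image Q = insert (Q k) ((Finset.range k).image Q) := by
  rw [Finset.range_add_one, Finset.image_insert]

theorem kids_inter_image_succ (h : T.IsQueue Q deg k t) (hk : k < t) (u : ℕ) :
    T.kids u ∩ (Finset.range (k + 1)).image Q =
      if u = T.par (Q k) then insert (Q k) (T.kids u ∩ (Finset.range k).image Q)
      else T.kids u ∩ (Finset.range k).image Q := by
  obtain ⟨h1, h2⟩ := h.bounds hk
  rw [image_succ]
  split_ifs with hu
  · subst hu
    rw [Finset.inter_insert_of_mem (T.mem_kids_par h1 h2)]
  · rw [Finset.inter_insert_of_notMem fun hm => hu (T.mem_kids.1 hm).2.symm]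

theorem deg_eq_succ (h : T.IsQueue Q deg k t) (hk : k < t) {deg' : ℕ → ℕ}
    (hdeg : ∀ u, deg' u = if u = T.par (Q k) then deg u - 1 else deg u) :
    ∀ u ≤ n, deg' u = (T.kids u \ (Finset.range (k + 1)).image Q).card := by
  intro u hu
  obtain ⟨h1, h2⟩ := h.bounds hk
  rw [hdeg, image_succ, Finset.sdiff_insert, h.deg_eq u hu]
  split_ifs with hp
  · subst hp
    rw [Finset.card_erase_of_mem
      (Finset.mem_sdiff.2 ⟨T.mem_kids_par h1 h2, h.notMem hk⟩)]
  · rw [Finset.erase_eq_of_notMem]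
    exact fun hm => hp (T.mem_kids.1 (Finset.mem_sdiff.1 hm).1).2.symm

theorem kids_subset_succ (h : T.IsQueue Q deg k t) (hk : k < t) :
    ∀ j < k + 1, T.kids (Q j) ⊆ (Finset.range j).image Q := by
  intro j hj
  rcases Nat.lt_succ_iff_lt_or_eq.1 hj with hj | rfl
  · exact h.kids_subset j hj
  · exact h.kids_subset_head hk

theorem par_notMem (h : T.IsQueue Q deg k t) (hk : k < t) :
    T.par (Q k) ∉ (Finset.range t).image Q := by
  obtain ⟨h1, h2⟩ := h.bounds hk
  exact fun hm => h.notMem hk (((h.mem _).1 hm).2 (T.mem_kids_par h1 h2))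

theorem kids_subset_image_succ_iff (h : T.IsQueue Q deg k t) (hk : k < t) (v : ℕ) :
    T.kids v ⊆ (Finset.range (k + 1)).image Q ↔
      if v = T.par (Q k) then deg v - 1 = 0 else T.kids v ⊆ (Finset.range k).image Q := by
  obtain ⟨h1, h2⟩ := h.bounds hk
  split_ifs with hv
  · subst hv
    have := h.deg_eq_succ hk (fun u => rfl) _ (T.par_le _ h1 h2)
    rw [if_pos rfl] at this
    rw [this, Finset.card_eq_zero, Finset.sdiff_eq_empty_iff_subset]
  · rw [image_succ, Finset.subset_insert_iff_of_notMem]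
    exact fun hm => hv (T.mem_kids.1 hm).2.symm

/-- Taking out the next node without a new entry. -/
theorem pop (h : T.IsQueue Q deg k t) (hk : k < t)
    (hd : ¬ (deg (T.par (Q k)) - 1 = 0 ∧ 0 < T.par (Q k))) {deg' : ℕ → ℕ}
    (hdeg : ∀ u, deg' u = if u = T.par (Q k) then deg u - 1 else deg u) :
    T.IsQueue Q deg' (k + 1) t where
  card := h.card
  le := hk
  mem v := by
    rw [h.kids_subset_image_succ_iff hk]
    split_ifs with hv
    · subst hv
      refine iff_of_false (h.par_notMem hk) fun hc => hd ⟨hc.2, hc.1.1⟩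
    · exact h.mem v
  kids_subset := h.kids_subset_succ hk
  deg_eq := h.deg_eq_succ hk hdeg

/-- Taking out the next node and entering its parent. -/
theorem pop_push (h : T.IsQueue Q deg k t) (hk : k < t)
    (hd : deg (T.par (Q k)) - 1 = 0 ∧ 0 < T.par (Q k)) {Q' deg' : ℕ → ℕ}
    (hQ : ∀ j, Q' j = if j = t then T.par (Q k) else Q j)
    (hdeg : ∀ u, deg' u = if u = T.par (Q k) then deg u - 1 else deg u) :
    T.IsQueue Q' deg' (k + 1) (t + 1) := by
  obtain ⟨h1, h2⟩ := h.bounds hk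
  have hQQ : ∀ j < t, Q' j = Q j := fun j hj => by rw [hQ, if_neg (by omega)]
  have him : ∀ j ≤ t, (Finset.range j).image Q' = (Finset.range j).image Q := fun j hj =>
    Finset.image_congr fun i hi => hQQ i (by have := Finset.mem_range.1 hi; omega)
  have hle := h.le
  have hQt : Q' t = T.par (Q k) := by rw [hQ, if_pos rfl]
  refine ⟨?_, by omega, fun v => ?_, fun j hj => ?_, ?_⟩
  · rw [image_succ, him t le_rfl, hQt, Finset.card_insert_of_notMem (h.par_notMem hk), h.card]
  · rw [image_succ, him t le_rfl, hQt, him (k + 1) hk, h.kids_subset_image_succ_iff hk,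
      Finset.mem_insert]
    split_ifs with hv
    · subst hv
      exact iff_of_true (.inl rfl) ⟨⟨hd.2, T.par_le _ h1 h2⟩, hd.1⟩
    · rw [h.mem v]
      simp [hv]
  · rw [him j (by omega), hQQ j (by omega)]
    exact h.kids_subset_succ hk j hj
  · rw [him (k + 1) hk]
    exact h.deg_eq_succ hk hdeg

theorem isPostorder (h : T.IsQueue Q deg n t) : T.IsPostorder Q := by
  have h1 := Finset.card_le_card h.subset
  rw [h.card, Nat.card_Icc] at h1
  obtain rfl : n = t := le_antisymm h.le (by omega)
  refine ⟨Finset.eq_of_subset_of_card_le h.subset ?_, h.kids_subset⟩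
  rw [h.card, Nat.card_Icc]
  omega

end IsQueue

namespace IsPostorder

theorem injOn (h : T.IsPostorder Q) : Set.InjOn Q (Finset.range n) :=
  Finset.card_image_iff.1 (by rw [h.image]; simp)

theorem bounds (h : T.IsPostorder Q) {j : ℕ} (hj : j < n) : 1 ≤ Q j ∧ Q j ≤ n :=
  Finset.mem_Icc.1 (h.image ▸ Finset.mem_image_of_mem Q (Finset.mem_range.2 hj))

theorem exists_eq (h : T.IsPostorder Q) {v : ℕ} (h1 : 1 ≤ v) (h2 : v ≤ n) :
    ∃ j < n, Q j = v := by
  have : v ∈ (Finset.range n).image Q := h.image ▸ Finset.mem_Icc.2 ⟨h1, h2⟩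
  simpa using this

/-- The parent of a node is the root or comes later. -/
theorem par_eq (h : T.IsPostorder Q) {j : ℕ} (hj : j < n) :
    T.par (Q j) = 0 ∨ ∃ i, j < i ∧ i < n ∧ Q i = T.par (Q j) := by
  obtain ⟨h1, h2⟩ := h.bounds hj
  rcases Nat.eq_zero_or_pos (T.par (Q j)) with h0 | h0
  · exact .inl h0
  · obtain ⟨i, hi, e⟩ := h.exists_eq h0 (T.par_le _ h1 h2)
    refine .inr ⟨i, ?_, hi, e⟩
    have := h.kids_subset i hi (e ▸ T.mem_kids_par h1 h2)
    obtain ⟨j', hj', e'⟩ := Finset.mem_image.1 this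
    have hj'' := Finset.mem_range.1 hj'
    have := h.injOn (by simp; omega) (by simpa using hj) e'
    omega

end IsPostorder

end ParentTree

namespace ParentTree

variable {n : ℕ} (T : ParentTree n)

theorem kidsExtent_le (m u : ℕ) : T.kidsExtent m u ≤ T.extent m u := by
  rcases (T.kids u).eq_empty_or_nonempty with h | h
  · simp [kidsExtent, h]
  · obtain ⟨c, hc, he⟩ := T.exists_heavy m h
    obtain ⟨_, hp⟩ := T.mem_kids.1 hc
    have h1 := T.width_add_slack m hc (by rw [IsLight, hp, he]; exact lt_irrefl _)
    have h2 := T.slack_le_of_mem_kids m hc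
    have h3 : 0 < T.width m u := T.width_pos m u
    rw [extent]
    omega

end ParentTree

theorem Nat.size_eq_size_half_add_one {x : ℕ} (hx : x ≠ 0) : Nat.size x = Nat.size (x / 2) + 1 := by
  have h := Nat.bit_bodd_div2 x
  rw [← Nat.div2_val]
  conv_lhs => rw [← h]
  exact Nat.size_bit (by rwa [h])

/-! ### The labeling program -/

namespace WordRAM

open WordRAM.Expr

/-- Word lengths with which no intermediate result in the computation of the labels of an `n`-node
forest overflows. -/
structure Fits (n w : ℕ) : Prop where
  labelLength_le : labelLength n ≤ w
  sq_lt : 8 * ((n + 1) * (n + 1)) < 2 ^ w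

/-- Counts the children of each node in array `2`, and tabulates the bit lengths of the numbers up
to `n` in array `3`. -/
def countProgram : Program :=
  .loop (op .lt (reg 1) (reg 0)) <|
    .seq (.assign 5 (load 0 (reg 1))) <|
    .seq (.store 2 (reg 5) (load 2 (reg 5) + 1)) <|
    .seq (.assign 1 (reg 1 + 1)) <|
    .store 3 (reg 1) (load 3 (reg 1 >>> 1) + 1)

/-- The state after `k` rounds of `countProgram`. -/
structure CountInv {n : ℕ} (T : ParentTree n) (k : ℕ) (s : State) : Prop where
  reg0 : s.reg 0 = n
  reg1 : s.reg 1 = k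
  reg2 : s.reg 2 = 0
  reg3 : s.reg 3 = 0
  par : ∀ i < n, s.arr 0 i = T.par (i + 1)
  deg : ∀ u, s.arr 2 u = {v ∈ Finset.Icc 1 k | T.par v = u}.card
  log : ∀ x ≤ k, s.arr 3 x = Nat.size x
  zero : ∀ a, 4 ≤ a → ∀ i, s.arr a i = 0

variable {n w : ℕ} {T : ParentTree n} {s s' : State}

theorem Fits.lt (h : Fits n w) : 8 * (n + 1) < 2 ^ w :=
  lt_of_le_of_lt (Nat.mul_le_mul_left 8 (Nat.le_mul_of_pos_left _ (by omega))) h.sq_lt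

theorem Fits.pos (h : Fits n w) : 0 < w := by
  have := h.labelLength_le
  rw [labelLength] at this
  omega

theorem toNat_decide_ne_zero {p : Prop} [Decidable p] (h : p) : (decide p).toNat ≠ 0 := by simp [h]

theorem toNat_decide_eq_zero {p : Prop} [Decidable p] (h : ¬ p) : (decide p).toNat = 0 := by
  simp [h]

theorem filter_Icc_succ (p : ℕ → Prop) [DecidablePred p] (k : ℕ) :
    {v ∈ Finset.Icc 1 (k + 1) | p v} =
      if p (k + 1) then insert (k + 1) {v ∈ Finset.Icc 1 k | p v}
      else {v ∈ Finset.Icc 1 k | p v} := by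
  rw [← Finset.insert_Icc_right_eq_Icc_add_one (by omega), Finset.filter_insert]

theorem count_runs (hw : Fits n w) (h : CountInv T 0 s) :
    Runs w countProgram s ((n + 1) * 30) (CountInv T n) := by
  have hn := hw.lt
  refine Runs.mono (Runs.loop (T := 24) (N := n) (CountInv T) h ?_ ?_ fun _ h => h) ?_ fun _ h => h
  · intro k hk s h
    refine ⟨?_, Computes.runs ?_ (by decide)⟩
    · rw [eval_lt (eval_reg h.reg1) (eval_reg h.reg0) hw.pos]
      exact toNat_decide_ne_zero hk
    have hdeg : {v ∈ Finset.Icc 1 k | T.par v = T.par (k + 1)}.card ≤ k :=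
      (Finset.card_filter_le _ _).trans (by simp)
    have hsize : Nat.size ((k + 1) / 2) ≤ n :=
      (Nat.size_le.2 Nat.lt_two_pow_self).trans (by omega)
    refine .seq_assign (T.par (k + 1)) (eval_load (eval_reg h.reg1) (h.par k hk)) ?_
    refine .seq_store (T.par (k + 1)) ({v ∈ Finset.Icc 1 k | T.par v = T.par (k + 1)}.card + 1)
      (eval_reg (by simp)) (eval_add (eval_load (eval_reg (by simp; rfl)) (by simp [h.deg]))
      (eval_const (by omega)) (by omega)) ?_
    refine .seq_assign (k + 1) (eval_add (eval_reg (by simp [h.reg1])) (eval_const (by omega))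
      (by omega)) ?_
    refine .store (k + 1) (Nat.size (k + 1)) (eval_reg (by simp)) ?_ ?_
    · rw [Nat.size_eq_size_half_add_one (by omega : k + 1 ≠ 0)]
      refine eval_add (eval_load (eval_shr (eval_reg (by simp; rfl)) (eval_const (by omega))) ?_)
        (eval_const (by omega)) (by omega)
      simp only [State.setReg_arr, State.setArr_arr, pow_one]
      exact h.log _ (by omega)
    · refine ⟨?_, ?_, ?_, ?_, ?_, ?_, ?_, ?_⟩
      · simp [h.reg0]
      · simp
      · simp [h.reg2]
      · simp [h.reg3]
      · intro i hi; simp [h.par i hi]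
      · intro u
        rw [filter_Icc_succ]
        by_cases hu : u = T.par (k + 1)
        · subst hu; simp
        · simp [hu, Ne.symm hu, h.deg]
      · intro x hx
        by_cases hxk : x = k + 1
        · simp [hxk]
        · simp [hxk, h.log x (by omega)]
      · intro a ha i
        simp [h.zero a ha, show a ≠ 2 by omega, show a ≠ 3 by omega]
  · intro s h
    rw [eval_lt (eval_reg h.reg1) (eval_reg h.reg0) hw.pos]
    exact toNat_decide_eq_zero (lt_irrefl _)
  · exact Nat.mul_le_mul_left _ (by decide)

/-- Computes `expBits n` in register `3` and `labelLength n` in register `9`. -/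
def setupProgram : Program :=
  .seq (.assign 4 (2 * load 3 (reg 0) + 4)) <|
  .seq (.loop (reg 4 >>> reg 3) (.assign 3 (reg 3 + 1))) <|
  .seq (.assign 9 (3 * reg 3 + 2 + (load 3 (reg 0) + 1))) <|
  .assign 1 0

/-- Enters the leaves into the queue, which is kept in array `4`; register `2` counts its
entries. -/
def leafProgram : Program :=
  .seq (.loop (op .lt (reg 1) (reg 0)) <|
    .seq (.assign 1 (reg 1 + 1)) <|
    .ite (load 2 (reg 1)) .skip <|
      .seq (.store 4 (reg 2) (reg 1)) (.assign 2 (reg 2 + 1))) <|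
  .assign 1 0

/-- The data that all later parts of the labeling program use and do not change. -/
structure Base (n : ℕ) (s : State) : Prop where
  reg0 : s.reg 0 = n
  reg3 : s.reg 3 = expBits n
  reg9 : s.reg 9 = labelLength n
  log : ∀ x ≤ n, s.arr 3 x = Nat.size x

theorem Base.of_eq (h : Base n s) (h0 : s'.reg 0 = s.reg 0) (h3 : s'.reg 3 = s.reg 3)
    (h9 : s'.reg 9 = s.reg 9) (ha : ∀ x, s'.arr 3 x = s.arr 3 x) : Base n s' :=
  ⟨h0 ▸ h.reg0, h3 ▸ h.reg3, h9 ▸ h.reg9, fun x hx => by rw [ha, h.log x hx]⟩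

/-- The state after `k` rounds of the loop in `leafProgram`. -/
structure LeafInv (T : ParentTree n) (k : ℕ) (s : State) : Prop where
  base : Base n s
  reg1 : s.reg 1 = k
  par : ∀ i < n, s.arr 0 i = T.par (i + 1)
  deg : ∀ u, s.arr 2 u = (T.kids u).card
  image : (Finset.range (s.reg 2)).image (s.arr 4) = {v ∈ Finset.Icc 1 k | T.kids v = ∅}
  card : ((Finset.range (s.reg 2)).image (s.arr 4)).card = s.reg 2
  zero : ∀ a, 5 ≤ a → ∀ i, s.arr a i = 0

theorem Fits.labelLength_lt (h : Fits n w) : labelLength n < 2 ^ w :=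
  h.labelLength_le.trans_lt Nat.lt_two_pow_self

theorem Fits.two_pow_lt (h : Fits n w) : 2 ^ expBits n < 2 ^ w := by
  have := h.labelLength_le
  rw [labelLength] at this
  exact Nat.pow_lt_pow_right one_lt_two (by omega)

theorem setup_runs (hw : Fits n w) (h : CountInv T n s) :
    Runs w setupProgram s ((n + 1) * 100) (LeafInv T 0) := by
  have hn := hw.lt
  have hl := hw.labelLength_lt
  have hm := two_mul_size_lt n
  have hmw := hw.two_pow_lt
  rw [labelLength] at hl
  have hlog := h.log n le_rfl
  have hsize : Nat.size n ≤ n := Nat.size_le.2 Nat.lt_two_pow_self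
  have hexp : expBits n ≤ 2 * Nat.size n + 4 := Nat.size_le.2 Nat.lt_two_pow_self
  refine Runs.mono (T := 8 + ((expBits n + 1) * 8 + 16)) (Runs.seq (Computes.runs (.assign
    (2 * Nat.size n + 4) (eval_add (eval_mul (eval_const (by omega))
    (eval_load (eval_reg h.reg0) hlog) (by omega)) (eval_const (by omega)) (by omega)) ?_)
    (by decide))) (by omega) fun _ h => h
  refine Runs.seq (Runs.mono (Runs.loop (T := 4) (N := expBits n)
    (fun k s' => s' = (s.setReg 4 (2 * Nat.size n + 4)).setReg 3 k) ?_ ?_ ?_ fun _ h => h)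
    (Nat.mul_le_mul_left _ (by decide)) ?_)
  · simp only [State.setReg]
    congr 1
    ext r
    simp only [Function.update_apply]
    by_cases h3 : r = 3
    · subst h3
      simp [h.reg3]
    · simp [h3]
  · rintro k hk _ rfl
    refine ⟨?_, Computes.runs (.assign (k + 1) (eval_add (eval_reg (by simp))
      (eval_const (by omega)) (by omega)) ?_) (by decide)⟩
    · rw [eval_shr (eval_reg (by simp; rfl)) (eval_reg (by simp; rfl))]
      exact (Nat.div_pos (Nat.lt_size.1 hk) (by positivity)).ne'
    · simp only [State.setReg, Function.update_idem]
  · rintro _ rfl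
    rw [eval_shr (eval_reg (by simp; rfl)) (eval_reg (by simp; rfl))]
    exact Nat.div_eq_of_lt hm
  · rintro _ rfl
    refine Computes.runs ?_ (by decide)
    refine .seq_assign (labelLength n) (eval_add (eval_add (eval_mul (eval_const (by omega))
      (eval_reg (by simp)) (by omega)) (eval_const (by omega)) (by omega))
      (eval_add (eval_load (eval_reg (by simp; exact h.reg0)) hlog) (eval_const (by omega))
        (by omega))
      (by omega)) ?_
    refine .assign 0 (eval_const (by positivity)) ?_
    refine ⟨⟨?_, ?_, ?_, ?_⟩, ?_, ?_, ?_, ?_, ?_, ?_⟩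
    · simp [h.reg0]
    · simp
    · simp
    · simpa using h.log
    · simp
    · simpa using h.par
    · intro u; simp [h.deg, ParentTree.kids]
    · simp [h.reg2]
    · simp [h.reg2]
    · intro a ha i; simp [h.zero a (by omega)]

/-- The state after `k` rounds of the loop in `queueProgram`. -/
structure QueueInv (T : ParentTree n) (k : ℕ) (s : State) : Prop where
  base : Base n s
  reg1 : s.reg 1 = k
  par : ∀ i < n, s.arr 0 i = T.par (i + 1)
  queue : T.IsQueue (s.arr 4) (s.arr 2) k (s.reg 2)
  sum : ∀ u ≤ n, s.arr 5 u =
    ∑ c ∈ T.kids u ∩ (Finset.range k).image (s.arr 4), T.extent (expBits n) c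
  top : ∀ u ≤ n, s.arr 6 u =
    (T.kids u ∩ (Finset.range k).image (s.arr 4)).sup (T.key (expBits n))
  width : ∀ v ∈ (Finset.range k).image (s.arr 4), s.arr 7 v = T.width (expBits n) v
  zero : ∀ a, 8 ≤ a → ∀ i, s.arr a i = 0

theorem leaf_runs (hw : Fits n w) (h : LeafInv T 0 s) :
    Runs w leafProgram s ((n + 1) * 30) (QueueInv T 0) := by
  have hn := hw.lt
  refine Runs.mono (T := (n + 1) * 28 + 2) (Runs.seq (Runs.mono (Runs.loop (T := 20) (N := n)
    (LeafInv T) h ?_ ?_ fun _ h => h) ?_ ?_)) (by omega) fun _ h => h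
  · intro k hk s h
    refine ⟨?_, Computes.runs ?_ (by decide)⟩
    · rw [eval_lt (eval_reg h.reg1) (eval_reg h.base.reg0) hw.pos]
      exact toNat_decide_ne_zero hk
    refine .seq_assign (k + 1) (eval_add (eval_reg h.reg1) (eval_const (by omega)) (by omega)) ?_
    have hev : (load 2 (reg 1)).eval w (s.setReg 1 (k + 1)) = (T.kids (k + 1)).card :=
      eval_load (eval_reg (by simp; rfl)) (by simp [h.deg])
    have him := filter_Icc_succ (fun v => T.kids v = ∅) k
    refine .ite (fun h0 => .skip ?_) fun h0 => ?_
    · rw [hev, Ne, Finset.card_eq_zero] at h0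
      rw [if_neg h0] at him
      refine ⟨h.base.of_eq ?_ ?_ ?_ ?_, ?_, ?_, ?_, ?_, ?_, ?_⟩
      · simp
      · simp
      · simp
      · simp
      · simp
      · simpa using h.par
      · simpa using h.deg
      · simpa [him] using h.image
      · simpa using h.card
      · simpa using h.zero
    · rw [hev, Finset.card_eq_zero] at h0
      rw [if_pos h0, ← h.image] at him
      have ht : s.reg 2 ≤ k := by
        rw [← h.card, h.image]
        exact (Finset.card_filter_le _ _).trans (by simp)
      have hnew : k + 1 ∉ (Finset.range (s.reg 2)).image (s.arr 4) := by
        rw [h.image]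
        simp
      refine .seq_store (s.reg 2) (k + 1) (eval_reg (by simp)) (eval_reg (by simp)) ?_
      refine .assign (s.reg 2 + 1) (eval_add (eval_reg (by simp)) (eval_const (by omega))
        (by omega)) ?_
      have him' : ∀ t, t = s.reg 2 → (Finset.range (t + 1)).image
          ((((s.setReg 1 (k + 1)).setArr 4 t (k + 1)).setReg 2 (t + 1)).arr 4) =
          insert (k + 1) ((Finset.range (s.reg 2)).image (s.arr 4)) := by
        rintro t rfl
        rw [ParentTree.IsQueue.image_succ]
        congr 1
        · simp
        · refine Finset.image_congr fun i hi => ?_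
          have := (Finset.mem_range.1 hi).ne
          simp [this]
      have him'' := him' _ rfl
      refine ⟨h.base.of_eq ?_ ?_ ?_ ?_, ?_, ?_, ?_, ?_, ?_, ?_⟩
      · simp
      · simp
      · simp
      · simp
      · simp
      · simpa using h.par
      · simpa using h.deg
      · rw [him, ← him'']
        simp
      · rw [State.setReg_reg, if_pos rfl, him'', Finset.card_insert_of_notMem hnew, h.card]
      · intro a ha i
        simp [show a ≠ 4 by omega, h.zero a ha]
  · intro s h
    rw [eval_lt (eval_reg h.reg1) (eval_reg h.base.reg0) hw.pos]
    exact toNat_decide_eq_zero (lt_irrefl _)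
  · exact Nat.mul_le_mul_left _ (by decide)
  · intro s h
    refine Computes.runs (.assign 0 (eval_const (by positivity)) ?_) (by decide)
    refine ⟨h.base.of_eq ?_ ?_ ?_ ?_, ?_, ?_, ⟨?_, ?_, ?_, ?_, ?_⟩, ?_, ?_, ?_, ?_⟩
    · simp
    · simp
    · simp
    · simp
    · simp
    · simpa using h.par
    · simpa using h.card
    · simp
    · intro v
      have := Finset.ext_iff.1 h.image v
      simpa using this
    · simp
    · intro u hu; simp [h.deg]
    · intro u hu; simp [h.zero]
    · intro u hu; simp [h.zero]
    · simp
    · intro a ha i; simp [h.zero a (by omega)]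

/-- Takes a node `v` out of the queue, computes its width in array `7`, and adds its extent and its
key to the data of its parent, in arrays `5` (the sum of the extents) and `6` (the maximum of the
keys). The parent enters the queue if `v` was its last remaining child. -/
def queueStep : Program :=
  .seq (.assign 4 (load 4 (reg 1))) <|
  .seq (.assign 5 (load 0 (reg 4 - 1))) <|
  .seq (.assign 6 (1 + load 5 (reg 4) - load 6 (reg 4) / (reg 0 + 1))) <|
  .seq (.store 7 (reg 4) (reg 6)) <|
  .seq (.assign 7 (reg 6 >>> reg 3)) <|
  .seq (.store 5 (reg 5) (load 5 (reg 5) + (reg 6 + reg 7))) <|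
  .seq (.assign 8 (reg 7 * (reg 0 + 1) + reg 4)) <|
  .seq (.store 6 (reg 5) (load 6 (reg 5) + (reg 8 - load 6 (reg 5)))) <|
  .seq (.store 2 (reg 5) (load 2 (reg 5) - 1)) <|
  .seq (.assign 1 (reg 1 + 1)) <|
  .ite (op .lt (load 2 (reg 5)) (op .lt 0 (reg 5)))
    (.seq (.store 4 (reg 2) (reg 5)) (.assign 2 (reg 2 + 1))) .skip

/-- Computes the widths, children before parents. -/
def queueProgram : Program :=
  .seq (.loop (op .lt (reg 1) (reg 0)) queueStep) <|
  .assign 1 0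

/-- Computes the offsets in array `9`, taking the nodes in the order of their numbers. Array `8`
accumulates the extents of the light children of each node. -/
def offsetProgram : Program :=
  .loop (op .lt (reg 1) (reg 0)) <|
    .seq (.assign 5 (load 0 (reg 1))) <|
    .seq (.assign 1 (reg 1 + 1)) <|
    .seq (.assign 6 (load 7 (reg 1))) <|
    .seq (.assign 7 (reg 6 >>> reg 3)) <|
    .ite (op .lt (reg 7 * (reg 0 + 1) + reg 1) (load 6 (reg 5)))
      (.seq (.store 9 (reg 1) (load 8 (reg 5)))
        (.store 8 (reg 5) (load 8 (reg 5) + (reg 6 + reg 7))))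
      (.store 9 (reg 1) (load 5 (reg 5) - (reg 6 + reg 7)))

/-- Computes the positions in array `10` and the labels, parents before children. Register `1`
counts down, so that the queue is read backwards. -/
def labelProgram : Program :=
  .loop (reg 1) <|
    .seq (.assign 1 (reg 1 - 1)) <|
    .seq (.assign 4 (load 4 (reg 1))) <|
    .seq (.assign 5 (load 10 (load 0 (reg 4 - 1)) + 1 + load 9 (reg 4))) <|
    .seq (.store 10 (reg 4) (reg 5)) <|
    .seq (.assign 6 (load 7 (reg 4))) <|
    .seq (.assign 8 (load 3 ((reg 6 >>> reg 3) >>> 1))) <|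
    .seq (.assign 7 ((reg 6 - 1) >>> reg 8)) <|
    .seq (.store 1 (reg 4 - 1) (1 <<< reg 3 +
      (reg 8 + (reg 7 + reg 5 <<< (reg 3 + 1)) <<< reg 3) <<< (reg 3 + 1))) <|
    .store 0 (reg 4 - 1) (reg 9)

theorem Fits.key_lt (hw : Fits n w) {v : ℕ} (hv : v ≤ n) :
    T.width (expBits n) v / 2 ^ expBits n * (n + 1) + v < 2 ^ w := by
  have h1 := hw.sq_lt
  have h2 : T.width (expBits n) v / 2 ^ expBits n * (n + 1) ≤ 2 * (n + 1) * (n + 1) :=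
    Nat.mul_le_mul_right _ ((Nat.div_le_self _ _).trans (T.width_le' hv))
  have h3 := Nat.le_mul_of_pos_left (n + 1) (by omega : 0 < n + 1)
  rw [mul_assoc] at h2
  omega

theorem extent_le {v : ℕ} (hv : v ≤ n) : T.extent (expBits n) v ≤ 4 * (n + 1) := by
  have h1 := T.width_le' hv
  have h2 : T.slack (expBits n) v ≤ T.width (expBits n) v := Nat.div_le_self _ _
  rw [ParentTree.extent]
  omega

theorem QueueInv.step {k v p : ℕ} (h : QueueInv T k s) (hk : k < s.reg 2) (hv : v = s.arr 4 k)
    (hp : p = T.par v) (hb : Base n s') (h1 : s'.reg 1 = k + 1)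
    (h0 : ∀ i < n, s'.arr 0 i = s.arr 0 i)
    (hq : T.IsQueue (s'.arr 4) (s'.arr 2) (k + 1) (s'.reg 2))
    (h4 : ∀ j ≤ k, s'.arr 4 j = s.arr 4 j)
    (h5 : ∀ u, s'.arr 5 u = if u = p then s.arr 5 u + T.extent (expBits n) v else s.arr 5 u)
    (h6 : ∀ u, s'.arr 6 u = if u = p then max (s.arr 6 u) (T.key (expBits n) v) else s.arr 6 u)
    (h7 : ∀ u, s'.arr 7 u = if u = v then T.width (expBits n) v else s.arr 7 u)
    (h8 : ∀ a, 8 ≤ a → ∀ i, s'.arr a i = s.arr a i) : QueueInv T (k + 1) s' := by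
  subst hv hp
  have him : (Finset.range (k + 1)).image (s'.arr 4) = (Finset.range (k + 1)).image (s.arr 4) :=
    Finset.image_congr fun j hj => h4 j (by simpa [Nat.lt_succ_iff] using hj)
  have hnew : ∀ u, s.arr 4 k ∉ T.kids u ∩ (Finset.range k).image (s.arr 4) := fun u hm =>
    h.queue.notMem hk (Finset.mem_inter.1 hm).2
  refine ⟨hb, h1, fun i hi => by rw [h0 i hi, h.par i hi], hq, fun u hu => ?_, fun u hu => ?_,
    fun u hu => ?_, fun a ha i => by rw [h8 a ha, h.zero a ha]⟩
  · rw [h5, him, h.queue.kids_inter_image_succ hk]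
    split_ifs
    · rw [Finset.sum_insert (hnew u), h.sum u hu, add_comm]
    · exact h.sum u hu
  · rw [h6, him, h.queue.kids_inter_image_succ hk]
    split_ifs
    · rw [Finset.sup_insert, h.top u hu, max_comm]
    · exact h.top u hu
  · rw [h7]
    split_ifs with huv
    · rw [huv]
    · rw [him, ParentTree.IsQueue.image_succ, Finset.mem_insert] at hu
      exact h.width u (hu.resolve_left huv)

/-- The state after `k` rounds of `offsetProgram`. -/
structure OffsetInv (T : ParentTree n) (k : ℕ) (s : State) : Prop where
  base : Base n s
  reg1 : s.reg 1 = k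
  par : ∀ i < n, s.arr 0 i = T.par (i + 1)
  order : T.IsPostorder (s.arr 4)
  sum : ∀ u ≤ n, s.arr 5 u = T.kidsExtent (expBits n) u
  top : ∀ u ≤ n, s.arr 6 u = T.topKey (expBits n) u
  width : ∀ v, 1 ≤ v → v ≤ n → s.arr 7 v = T.width (expBits n) v
  light : ∀ u ≤ n, s.arr 8 u =
    ∑ c ∈ T.kids u with c ≤ k ∧ T.IsLight (expBits n) c, T.extent (expBits n) c
  offset : ∀ v, 1 ≤ v → v ≤ k → s.arr 9 v = T.offset (expBits n) v
  root : s.arr 10 0 = 0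

theorem queueStep_runs {k : ℕ} (hw : Fits n w) (hk : k < n) (h : QueueInv T k s) :
    Runs w queueStep s 100 (QueueInv T (k + 1)) := by
  have hn := hw.lt
  have hkt := h.queue.lt hk
  obtain ⟨hv1, hv2⟩ := h.queue.bounds hkt
  generalize hv : s.arr 4 k = v at hv1 hv2
  have hp2 := T.par_le v hv1 hv2
  have hpar := h.par (v - 1) (by omega)
  rw [Nat.sub_add_cancel hv1] at hpar
  generalize hp : T.par v = p at hp2 hpar
  have hsub := h.queue.kids_subset_head hkt
  rw [hv] at hsub
  have hS : s.arr 5 v = T.kidsExtent (expBits n) v := by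
    rw [h.sum v hv2, Finset.inter_eq_left.2 hsub, ParentTree.kidsExtent]
  have hK : s.arr 6 v = T.topKey (expBits n) v := by
    rw [h.top v hv2, Finset.inter_eq_left.2 hsub, ParentTree.topKey]
  have hKE : ∀ u ≤ n, T.kidsExtent (expBits n) u ≤ 4 * (n + 1) := fun u hu =>
    (T.kidsExtent_le _ u).trans (extent_le hu)
  have hSp : s.arr 5 p ≤ 4 * (n + 1) := by
    rw [h.sum p hp2]
    exact (Finset.sum_le_sum_of_subset Finset.inter_subset_left).trans (hKE p hp2)
  have hKp : s.arr 6 p ≤ T.topKey (expBits n) p := by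
    rw [h.top p hp2]
    exact Finset.sup_mono Finset.inter_subset_left
  have hE := extent_le (T := T) hv2
  have hkey := hw.key_lt (T := T) hv2
  have ht : s.reg 2 ≤ n := by
    have := Finset.card_le_card h.queue.subset
    rwa [h.queue.card, Nat.card_Icc, Nat.add_sub_cancel] at this
  have hKlt : s.arr 6 p < 2 ^ w := by
    refine hKp.trans_lt ((Finset.sup_lt_iff (by positivity)).2 fun c hc => ?_)
    exact hw.key_lt (T.mem_kids.1 hc).1.2
  simp only [ParentTree.extent, ParentTree.slack] at hE
  have hKE' := hKE v hv2
  refine Computes.runs ?_ (by decide)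
  refine .seq_assign v (eval_load (eval_reg h.reg1) hv) ?_
  refine .seq_assign p (eval_load (eval_sub (eval_reg (by simp; rfl)) (eval_const (by omega)))
    (by simpa using hpar)) ?_
  refine .seq_assign (T.width (expBits n) v) ((eval_sub (eval_add (eval_const (by omega))
    (eval_load (eval_reg (by simp; rfl)) (by simpa using hS)) (by omega)) (eval_div
    (eval_load (eval_reg (by simp; rfl)) (by simpa using hK)) (eval_add
    (eval_reg (by simpa using h.base.reg0)) (eval_const (by omega)) (by omega)))).trans
    (T.width_eq _ v).symm) ?_
  refine .seq_store v (T.width (expBits n) v) (eval_reg (by simp)) (eval_reg (by simp)) ?_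
  refine .seq_assign (T.width (expBits n) v / 2 ^ expBits n) (eval_shr (eval_reg (by simp))
    (eval_reg (by simpa using h.base.reg3))) ?_
  refine .seq_store p (s.arr 5 p + (T.width (expBits n) v + T.width (expBits n) v / 2 ^ expBits n))
    (eval_reg (by simp)) (eval_add (eval_load (eval_reg (by simp; rfl)) (by simp)) (eval_add
    (eval_reg (by simp)) (eval_reg (by simp)) (by omega)) (by omega)) ?_
  refine .seq_assign (T.width (expBits n) v / 2 ^ expBits n * (n + 1) + v) (eval_add (eval_mul
    (eval_reg (by simp)) (eval_add (eval_reg (by simpa using h.base.reg0)) (eval_const (by omega))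
    (by omega)) (by omega)) (eval_reg (by simp)) hkey) ?_
  refine .seq_store p
    (s.arr 6 p + (T.width (expBits n) v / 2 ^ expBits n * (n + 1) + v - s.arr 6 p))
    (eval_reg (by simp)) (eval_add (eval_load (eval_reg (by simp; rfl)) (by simp))
    (eval_sub (eval_reg (by simp)) (eval_load (eval_reg (by simp; rfl)) (by simp)))
    (by omega)) ?_
  refine .seq_store p (s.arr 2 p - 1) (eval_reg (by simp)) (eval_sub (eval_load
    (eval_reg (by simp; rfl)) (by simp)) (eval_const (by omega))) ?_
  refine .seq_assign (k + 1) (eval_add (eval_reg (by simpa using h.reg1)) (eval_const (by omega))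
    (by omega)) ?_
  have hlt := fun st : State => fun (h2 : (load 2 (reg 5)).eval w st = s.arr 2 p - 1)
    (h5 : st.reg 5 = p) => eval_lt h2 (eval_lt (eval_const (c := 0) (by positivity))
      (eval_reg h5) hw.pos) hw.pos
  -- truncated subtraction computes the maximum
  have hmax : s.arr 6 p + (T.width (expBits n) v / 2 ^ expBits n * (n + 1) + v - s.arr 6 p) =
      max (s.arr 6 p) (T.key (expBits n) v) := by
    simp only [ParentTree.key, ParentTree.slack]
    omega
  have hext : T.width (expBits n) v + T.width (expBits n) v / 2 ^ expBits n =
      T.extent (expBits n) v := rfl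
  rw [hmax, hext]
  have hcond : ∀ x y : ℕ, x < (decide (0 < y)).toNat ↔ x = 0 ∧ 0 < y := by
    intro x y
    rcases Nat.eq_zero_or_pos y with rfl | hy
    · simp
    · simp [hy]
  refine .ite (fun h0 => ?_) fun h0 => .skip ?_
  · rw [hlt _ (eval_load (eval_reg (by simp; rfl)) (by simp)) (by simp)] at h0
    have h0' : s.arr 2 p - 1 = 0 ∧ 0 < p := by
      by_contra hc
      exact h0 (toNat_decide_eq_zero (mt (hcond _ _).1 hc))
    refine .seq_store (s.reg 2) p (eval_reg (by simp)) (eval_reg (by simp)) ?_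
    refine .assign (s.reg 2 + 1) (eval_add (eval_reg (by simp)) (eval_const (by omega))
      (by omega)) ?_
    refine h.step hkt hv.symm hp.symm (h.base.of_eq ?_ ?_ ?_ ?_) ?_ ?_ ?_ ?_ ?_ ?_ ?_ ?_
    · simp
    · simp
    · simp
    · simp
    · simp
    · simp
    · rw [State.setReg_reg, if_pos rfl]
      refine h.queue.pop_push hkt (by rw [hv, hp]; exact h0') ?_ ?_
      · intro j; simp [hv, hp]
      · intro u; simp only [hv, hp]; by_cases hu : u = p <;> simp [hu]
    · intro j hj
      have : j ≠ s.reg 2 := by omega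
      simp [this]
    · intro u; by_cases hu : u = p <;> simp [hu]
    · intro u; by_cases hu : u = p <;> simp [hu]
    · intro u; simp
    · intro a ha i
      simp [show a ≠ 4 by omega, show a ≠ 2 by omega, show a ≠ 6 by omega, show a ≠ 5 by omega,
        show a ≠ 7 by omega]
  · rw [hlt _ (eval_load (eval_reg (by simp; rfl)) (by simp)) (by simp)] at h0
    have h0' : ¬ (s.arr 2 p - 1 = 0 ∧ 0 < p) := fun hc =>
      toNat_decide_ne_zero ((hcond _ _).2 hc) h0
    refine h.step hkt hv.symm hp.symm (h.base.of_eq ?_ ?_ ?_ ?_) ?_ ?_ ?_ ?_ ?_ ?_ ?_ ?_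
    · simp
    · simp
    · simp
    · simp
    · simp
    · simp
    · have := h.queue.pop hkt (by rw [hv, hp]; exact h0') (deg' := fun u =>
        if u = p then s.arr 2 u - 1 else s.arr 2 u) (by intro u; simp only [hv, hp])
      convert this using 1
      · ext j; simp
      · ext u; by_cases hu : u = p <;> simp [hu]
      · simp
    · simp
    · intro u; by_cases hu : u = p <;> simp [hu]
    · intro u; by_cases hu : u = p <;> simp [hu]
    · intro u; simp
    · intro a ha i
      simp [show a ≠ 2 by omega, show a ≠ 6 by omega, show a ≠ 5 by omega, show a ≠ 7 by omega]

theorem queue_runs (hw : Fits n w) (h : QueueInv T 0 s) :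
    Runs w queueProgram s ((n + 1) * 120) (OffsetInv T 0) := by
  refine Runs.mono (T := (n + 1) * 110 + 2) (Runs.seq (Runs.mono (Runs.loop (T := 100) (N := n)
    (QueueInv T) h ?_ ?_ fun _ h => h) ?_ ?_)) (by omega) fun _ h => h
  · intro k hk s h
    refine ⟨?_, queueStep_runs hw hk h⟩
    rw [eval_lt (eval_reg h.reg1) (eval_reg h.base.reg0) hw.pos]
    exact toNat_decide_ne_zero hk
  · intro s h
    rw [eval_lt (eval_reg h.reg1) (eval_reg h.base.reg0) hw.pos]
    exact toNat_decide_eq_zero (lt_irrefl _)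
  · exact Nat.mul_le_mul_left _ (by decide)
  · intro s h
    have ho := h.queue.isPostorder
    have hin : ∀ u, T.kids u ∩ (Finset.range n).image (s.arr 4) = T.kids u := fun u => by
      rw [ho.image]
      exact Finset.inter_eq_left.2 (Finset.filter_subset _ _)
    refine Computes.runs (.assign 0 (eval_const (by positivity)) ?_) (by decide)
    refine ⟨h.base.of_eq ?_ ?_ ?_ ?_, ?_, ?_, ?_, ?_, ?_, ?_, ?_, ?_, ?_⟩
    · simp
    · simp
    · simp
    · simp
    · simp
    · simpa using h.par
    · exact ho
    · intro u hu; simp [h.sum u hu, hin, ParentTree.kidsExtent]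
    · intro u hu; simp [h.top u hu, hin, ParentTree.topKey]
    · intro v h1 h2
      exact h.width v (by rw [ho.image]; exact Finset.mem_Icc.2 ⟨h1, h2⟩)
    · intro u hu
      rw [Finset.sum_eq_zero]
      · simp [h.zero]
      · intro c hc
        have h1 := (T.mem_kids.1 (Finset.mem_filter.1 hc).1).1.1
        have h2 := (Finset.mem_filter.1 hc).2.1
        omega
    · intro v h1 h2; omega
    · simp [h.zero]

theorem filter_kids_succ (m k u : ℕ) :
    {c ∈ T.kids u | c ≤ k + 1 ∧ T.IsLight m c} =
      if k + 1 ∈ T.kids u ∧ T.IsLight m (k + 1) then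
        insert (k + 1) {c ∈ T.kids u | c ≤ k ∧ T.IsLight m c}
      else {c ∈ T.kids u | c ≤ k ∧ T.IsLight m c} := by
  ext c
  split_ifs with h
  · simp only [Finset.mem_filter, Finset.mem_insert]
    constructor
    · rintro ⟨h1, h2, h3⟩
      rcases h2.eq_or_lt with e | e
      · exact .inl e
      · exact .inr ⟨h1, by omega, h3⟩
    · rintro (rfl | ⟨h1, h2, h3⟩)
      · exact ⟨h.1, le_rfl, h.2⟩
      · exact ⟨h1, by omega, h3⟩
  · simp only [Finset.mem_filter]
    constructor
    · rintro ⟨h1, h2, h3⟩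
      refine ⟨h1, ?_, h3⟩
      rcases h2.eq_or_lt with rfl | e
      · exact absurd ⟨h1, h3⟩ h
      · omega
    · rintro ⟨h1, h2, h3⟩
      exact ⟨h1, by omega, h3⟩

theorem offset_runs (hw : Fits n w) (h : OffsetInv T 0 s) :
    Runs w offsetProgram s ((n + 1) * 60) (OffsetInv T n) := by
  have hn := hw.lt
  refine Runs.mono (Runs.loop (T := 50) (N := n) (OffsetInv T) h ?_ ?_ fun _ h => h)
    (Nat.mul_le_mul_left _ (by decide)) fun _ h => h
  · intro k hk s h
    refine ⟨?_, Computes.runs ?_ (by decide)⟩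
    · rw [eval_lt (eval_reg h.reg1) (eval_reg h.base.reg0) hw.pos]
      exact toNat_decide_ne_zero hk
    have hk' : k + 1 ≤ n := hk
    have hp2 := T.par_le (k + 1) (by omega) hk'
    have hpar := h.par k hk
    have hoff : T.offset (expBits n) (k + 1) = if T.IsLight (expBits n) (k + 1) then
      ∑ c ∈ T.kids (T.par (k + 1)) with c < k + 1 ∧ T.IsLight (expBits n) c, T.extent (expBits n) c
      else T.kidsExtent (expBits n) (T.par (k + 1)) - T.extent (expBits n) (k + 1) := rfl
    have hlight : T.IsLight (expBits n) (k + 1) ↔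
      T.key (expBits n) (k + 1) < T.topKey (expBits n) (T.par (k + 1)) := Iff.rfl
    have hmem' : ∀ u, k + 1 ∈ T.kids u ↔ u = T.par (k + 1) := fun u => by
      rw [T.mem_kids]
      exact ⟨fun h => h.2.symm, fun h => ⟨⟨by omega, hk⟩, h.symm⟩⟩
    have hsucc := fun u => filter_kids_succ (T := T) (expBits n) k u
    simp only [hmem'] at hsucc
    generalize T.par (k + 1) = p at *
    have hE := extent_le (T := T) hk'
    have hkey := hw.key_lt (T := T) hk'
    have hA : s.arr 8 p ≤ 4 * (n + 1) := by
      rw [h.light p hp2]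
      exact (Finset.sum_le_sum_of_subset (Finset.filter_subset _ _)).trans
        ((T.kidsExtent_le (expBits n) p).trans (extent_le hp2))
    have hext : T.width (expBits n) (k + 1) + T.width (expBits n) (k + 1) / 2 ^ expBits n =
      T.extent (expBits n) (k + 1) := rfl
    refine .seq_assign p (eval_load (eval_reg h.reg1) hpar) ?_
    refine .seq_assign (k + 1) (eval_add (eval_reg (by simpa using h.reg1)) (eval_const (by omega))
      (by omega)) ?_
    refine .seq_assign (T.width (expBits n) (k + 1)) (eval_load (eval_reg (by simp; rfl))
      (by simpa using h.width (k + 1) (by omega) hk)) ?_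
    refine .seq_assign (T.width (expBits n) (k + 1) / 2 ^ expBits n) (eval_shr (eval_reg (by simp))
      (eval_reg (by simpa using h.base.reg3))) ?_
    have hlt : ∀ st : State, st.reg 0 = n → st.reg 1 = k + 1 →
        st.reg 7 = T.width (expBits n) (k + 1) / 2 ^ expBits n →
        (load 6 (reg 5)).eval w st = T.topKey (expBits n) p →
        (op .lt (reg 7 * (reg 0 + 1) + reg 1) (load 6 (reg 5))).eval w st =
          (decide (T.key (expBits n) (k + 1) < T.topKey (expBits n) p)).toNat :=
      fun st h0 h1 h7 h6 => eval_lt (eval_add (eval_mul (eval_reg h7) (eval_add (eval_reg h0)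
        (eval_const (by omega)) (by omega)) ((Nat.le_add_right _ _).trans_lt hkey))
        (eval_reg h1) hkey) h6 hw.pos
    have hlt' := hlt ((((s.setReg 5 p).setReg 1 (k + 1)).setReg 6
      (T.width (expBits n) (k + 1))).setReg 7 (T.width (expBits n) (k + 1) / 2 ^ expBits n))
      (by simpa using h.base.reg0) (by simp)
      (by simp) (eval_load (eval_reg (by simp; rfl)) (by simpa using h.top p hp2))
    refine .ite (fun h0 => ?_) fun h0 => ?_
    · rw [hlt'] at h0
      have hl : T.IsLight (expBits n) (k + 1) := by
        by_contra hc
        exact h0 (toNat_decide_eq_zero (mt hlight.2 hc))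
      refine .seq_store (k + 1) (s.arr 8 p) (eval_reg (by simp)) (eval_load
        (eval_reg (by simp; rfl)) (by simp)) ?_
      refine .store p (s.arr 8 p + (T.width (expBits n) (k + 1) +
        T.width (expBits n) (k + 1) / 2 ^ expBits n)) (eval_reg (by simp)) (eval_add (eval_load
        (eval_reg (by simp; rfl)) (by simp)) (eval_add (eval_reg (by simp)) (eval_reg (by simp))
        (by omega)) (by omega)) ?_
      refine ⟨h.base.of_eq ?_ ?_ ?_ ?_, ?_, ?_, ?_, ?_, ?_, ?_, ?_, ?_, ?_⟩
      · simp
      · simp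
      · simp
      · simp
      · simp
      · simpa using h.par
      · have := h.order
        convert this using 1
        ext j; simp
      · simpa using h.sum
      · simpa using h.top
      · simpa using h.width
      · intro u hu
        rw [hsucc]
        by_cases hup : u = p
        · subst hup
          rw [if_pos ⟨rfl, hl⟩, Finset.sum_insert (by simp), ← h.light u hu, ← hext]
          simp [add_comm]
        · simp [hup, h.light u hu]
      · intro v h1 h2
        by_cases hv : v = k + 1
        · subst hv
          rw [hoff, if_pos hl]
          simp [h.light p hp2]
        · simp [hv, h.offset v h1 (by omega)]
      · simpa using h.root
    · rw [hlt'] at h0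
      have hl : ¬ T.IsLight (expBits n) (k + 1) := fun hc => toNat_decide_ne_zero (hlight.1 hc) h0
      refine .store (k + 1) (T.kidsExtent (expBits n) p - (T.width (expBits n) (k + 1) +
        T.width (expBits n) (k + 1) / 2 ^ expBits n)) (eval_reg (by simp)) (eval_sub (eval_load
        (eval_reg (by simp; rfl)) (by simpa using h.sum p hp2)) (eval_add (eval_reg (by simp))
        (eval_reg (by simp)) (by omega))) ?_
      refine ⟨h.base.of_eq ?_ ?_ ?_ ?_, ?_, ?_, ?_, ?_, ?_, ?_, ?_, ?_, ?_⟩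
      · simp
      · simp
      · simp
      · simp
      · simp
      · simpa using h.par
      · have := h.order
        convert this using 1
        ext j; simp
      · simpa using h.sum
      · simpa using h.top
      · simpa using h.width
      · intro u hu
        rw [hsucc, if_neg fun hc => hl hc.2, ← h.light u hu]
        simp
      · intro v h1 h2
        by_cases hv : v = k + 1
        · subst hv
          rw [hoff, if_neg hl]
          simp [hext]
        · simp [hv, h.offset v h1 (by omega)]
      · simpa using h.root
  · intro s h
    rw [eval_lt (eval_reg h.reg1) (eval_reg h.base.reg0) hw.pos]
    exact toNat_decide_eq_zero (lt_irrefl _)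

/-- The state after `k` rounds of `labelProgram`, which have treated the last `k` entries of the
queue. The labels overwrite the parents in array `0` only after these have been used. -/
structure LabelInv (T : ParentTree n) (k : ℕ) (s : State) : Prop where
  base : Base n s
  reg1 : s.reg 1 = n - k
  order : T.IsPostorder (s.arr 4)
  width : ∀ v, 1 ≤ v → v ≤ n → s.arr 7 v = T.width (expBits n) v
  offset : ∀ v, 1 ≤ v → v ≤ n → s.arr 9 v = T.offset (expBits n) v
  root : s.arr 10 0 = 0
  par : ∀ j < n - k, s.arr 0 (s.arr 4 j - 1) = T.par (s.arr 4 j)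
  pos : ∀ j < n, n - k ≤ j → s.arr 10 (s.arr 4 j) = T.pos (expBits n) (s.arr 4 j)
  label : ∀ j < n, n - k ≤ j → s.arr 0 (s.arr 4 j - 1) = labelLength n ∧
    s.arr 1 (s.arr 4 j - 1) = T.labelValue (s.arr 4 j)

theorem label_runs (hw : Fits n w) (h : OffsetInv T n s) :
    Runs w labelProgram s ((n + 1) * 80) fun s' =>
      ∀ v < n, s'.arr 0 v = labelLength n ∧ s'.arr 1 v = T.labelValue (v + 1) := by
  have hn := hw.lt
  refine Runs.mono (Runs.loop (T := 70) (N := n) (LabelInv T) ?_ ?_ ?_ ?_)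
    (Nat.mul_le_mul_left _ (by decide)) fun _ h => h
  · refine ⟨h.base, h.reg1, h.order, h.width, h.offset, h.root, ?_, ?_, ?_⟩
    · intro j hj
      have := h.order.bounds hj
      rw [h.par _ (by omega), Nat.sub_add_cancel this.1]
    · intro j h1 h2; omega
    · intro j h1 h2; omega
  · intro k hk s h
    refine ⟨?_, Computes.runs ?_ (by decide)⟩
    · rw [eval_reg h.reg1]
      omega
    obtain ⟨j, hj⟩ : ∃ j, j = n - k - 1 := ⟨_, rfl⟩
    have hjn : j < n := by omega
    obtain ⟨hv1, hv2⟩ := h.order.bounds hjn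
    have hpar := h.par j (by omega)
    -- the parent comes later in the queue, so its position is known already
    have hpp : s.arr 10 (T.par (s.arr 4 j)) = T.pos (expBits n) (T.par (s.arr 4 j)) := by
      rcases h.order.par_eq hjn with e | ⟨i, h1, h2, e⟩
      · rw [e, h.root, T.pos_zero]
      · rw [← e]
        exact h.pos i h2 (by omega)
    have hinj : ∀ i < n, s.arr 4 i - 1 = s.arr 4 j - 1 → i = j := fun i hi e => by
      have := h.order.bounds hi
      exact h.order.injOn (by simpa using hi) (by simpa using hjn) (by omega)
    have hinj' : ∀ i < n, s.arr 4 i = s.arr 4 j → i = j := fun i hi e => hinj i hi (by rw [e])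
    have hpos := T.pos_eq (expBits n) hv1 hv2
    have hposlt := T.pos_add_width_le (expBits n) hv2
    have hw0 := T.width_le' (Nat.zero_le n)
    have hwv := T.width_le' hv2
    have hoff := h.offset _ hv1 hv2
    have hwid := h.width _ hv1 hv2
    have hlab : T.labelValue (s.arr 4 j) < 2 ^ w :=
      (T.labelValue_lt hv2).trans_le (Nat.pow_le_pow_right (by norm_num) hw.labelLength_le)
    have hlabeq : T.labelValue (s.arr 4 j) = 2 ^ expBits n + 2 ^ (expBits n + 1) *
      (roundExp (expBits n) (T.width (expBits n) (s.arr 4 j)) + 2 ^ expBits n *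
        (roundMant (expBits n) (T.width (expBits n) (s.arr 4 j)) +
          2 ^ (expBits n + 1) * T.pos (expBits n) (s.arr 4 j))) := rfl
    have hll := hw.labelLength_lt
    rw [labelLength] at hll
    have hexp : roundExp (expBits n) (T.width (expBits n) (s.arr 4 j)) = Nat.size
      (T.width (expBits n) (s.arr 4 j) / 2 ^ expBits n / 2) := rfl
    have hmant : roundMant (expBits n) (T.width (expBits n) (s.arr 4 j)) =
      (T.width (expBits n) (s.arr 4 j) - 1) /
        2 ^ roundExp (expBits n) (T.width (expBits n) (s.arr 4 j)) := rfl
    -- the argument of the bit length lies in the range of the table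
    have hidx : T.width (expBits n) (s.arr 4 j) / 2 ^ expBits n / 2 ≤ n := by
      have : T.width (expBits n) (s.arr 4 j) / 2 ^ expBits n ≤
          T.width (expBits n) (s.arr 4 j) / 2 :=
        Nat.div_le_div_left (by have := two_mul_size_lt n; omega) (by norm_num)
      omega
    generalize hv : s.arr 4 j = v at *
    generalize T.par v = p at *
    generalize T.width (expBits n) v = x at *
    generalize roundExp (expBits n) x = e at *
    generalize roundMant (expBits n) x = f at *
    generalize hl : T.labelValue v = l at *
    generalize ha : T.pos (expBits n) v = a at *
    generalize T.offset (expBits n) v = o at *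
    generalize hq : T.pos (expBits n) p = q at *
    have m1 : a ≤ 2 ^ (expBits n + 1) * a := Nat.le_mul_of_pos_left _ (by positivity)
    have m2 : f + 2 ^ (expBits n + 1) * a ≤ 2 ^ expBits n * (f + 2 ^ (expBits n + 1) * a) :=
      Nat.le_mul_of_pos_left _ (by positivity)
    have m3 : e + 2 ^ expBits n * (f + 2 ^ (expBits n + 1) * a) ≤
      2 ^ (expBits n + 1) * (e + 2 ^ expBits n * (f + 2 ^ (expBits n + 1) * a)) :=
      Nat.le_mul_of_pos_left _ (by positivity)
    have hreg3 := h.base.reg3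
    have hsub : n - (k + 1) = j := by omega
    refine .seq_assign j ((eval_sub (eval_reg h.reg1) (eval_const (by omega))).trans hj.symm) ?_
    refine .seq_assign v (eval_load (eval_reg (by simp; rfl)) (by simpa using hv)) ?_
    refine .seq_assign a ((eval_add (eval_add (eval_load (eval_load (eval_sub
      (eval_reg (by simp; rfl)) (eval_const (by omega))) (by simpa using hpar))
      (by simpa using hpp))
      (eval_const (by omega)) (by omega)) (eval_load (eval_reg (by simp; rfl))
      (by simpa using hoff)) (by omega)).trans hpos.symm) ?_
    refine .seq_store v a (eval_reg (by simp)) (eval_reg (by simp)) ?_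
    refine .seq_assign x (eval_load (eval_reg (by simp; rfl)) (by simpa using hwid)) ?_
    refine .seq_assign e (eval_load (eval_shr (eval_shr (eval_reg (by simp; rfl))
      (eval_reg (by simpa using hreg3))) (eval_const (by omega))) ?_) ?_
    · rw [hexp]
      simpa using h.base.log _ hidx
    refine .seq_assign f ((eval_shr (eval_sub (eval_reg (by simp)) (eval_const (by omega)))
      (eval_reg (by simp))).trans hmant.symm) ?_
    refine .seq_store (v - 1) l (eval_sub (eval_reg (by simp)) (eval_const (by omega))) ?_ ?_
    · have hm1 : ∀ st : State, st.reg 3 = expBits n →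
          (reg 3 + 1 : Expr).eval w st = expBits n + 1 := fun st h3 =>
        eval_add (eval_reg h3) (eval_const (by omega)) (by omega)
      have hone : 1 < 2 ^ w := by omega
      have hpow : 0 < 2 ^ expBits n := by positivity
      rw [hlabeq] at hlab
      refine (eval_add (eval_shl (eval_const hone) (eval_reg (by simpa using hreg3))
        ?_) (eval_shl (eval_add (eval_reg (by simp; rfl)) (eval_shl (eval_add
        (eval_reg (by simp; rfl)) (eval_shl (eval_reg (by simp; rfl)) (hm1 _ (by simpa using hreg3))
        ?_) ?_) (eval_reg (by simpa using hreg3)) ?_) ?_) (hm1 _ (by simpa using hreg3)) ?_)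
        ?_).trans ?_
      all_goals simp only [mul_comm _ (2 ^ _), mul_one]
      all_goals omega
    refine .store (v - 1) (labelLength n) (eval_sub (eval_reg (by simp)) (eval_const (by omega)))
      (eval_reg (by simpa using h.base.reg9)) ?_
    have hQ : (((((((((s.setReg 1 j).setReg 4 v).setReg 5 a).setArr 10 v a).setReg 6 x).setReg 8
      e).setReg 7 f).setArr 1 (v - 1) l).setArr 0 (v - 1) (labelLength n)).arr 4 = s.arr 4 := by
      ext i; simp
    refine ⟨h.base.of_eq ?_ ?_ ?_ ?_, ?_, ?_, ?_, ?_, ?_, ?_, ?_, ?_⟩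
    · simp
    · simp
    · simp
    · simp
    · simp [hsub]
    · rw [hQ]; exact h.order
    · simpa using h.width
    · simpa using h.offset
    · simp [h.root, show 0 ≠ v by omega]
    · intro i hi
      rw [hQ]
      have : ¬ s.arr 4 i - 1 = v - 1 := fun e => by
        have := hinj i (by omega) e
        omega
      simpa [this] using h.par i (by omega)
    · intro i hi hi'
      rw [hQ]
      by_cases hij : i = j
      · subst hij
        simp [hv, ha]
      · have : ¬ s.arr 4 i = v := fun e => hij (hinj' i hi e)
        simpa [this] using h.pos i hi (by omega)
    · intro i hi hi'
      rw [hQ]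
      by_cases hij : i = j
      · subst hij
        simp [hv, hl]
      · have : ¬ s.arr 4 i - 1 = v - 1 := fun e => hij (hinj i hi e)
        simpa [this] using h.label i hi (by omega)
  · intro s h
    rw [eval_reg h.reg1, Nat.sub_self]
  · intro s h v hv
    obtain ⟨j, hj, e⟩ := h.order.exists_eq (Nat.succ_pos v) hv
    have := h.label j hj (by omega)
    rw [e] at this
    exact this

/-- The labeling program. Its registers `0`, `1`, `2`, `3` and `9` hold `n`, a loop counter, the
number of entries of the queue, `expBits n` and `labelLength n`; registers `4` to `8` hold data of
the node at hand. The nodes are numbered as in `ParentTree`. -/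
def markerProgram : Program :=
  .seq countProgram <| .seq setupProgram <| .seq leafProgram <| .seq queueProgram <|
    .seq offsetProgram labelProgram

theorem marker_runs {n w : ℕ} {T : ParentTree n} {s : State} (hw : Fits n w)
    (h : CountInv T 0 s) : Runs w markerProgram s (420 * (n + 1)) fun s' =>
      ∀ v < n, s'.arr 0 v = labelLength n ∧ s'.arr 1 v = T.labelValue (v + 1) := by
  refine Runs.mono (.seq <| (count_runs hw h).mono le_rfl fun _ h => .seq <|
    (setup_runs hw h).mono le_rfl fun _ h => .seq <|
    (leaf_runs hw h).mono le_rfl fun _ h => .seq <|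
    (queue_runs hw h).mono le_rfl fun _ h => .seq <|
    (offset_runs hw h).mono le_rfl fun _ h => label_runs hw h) (by omega) fun _ h => h

theorem forestInput_countInv {n : ℕ} (F : RootedForest n) :
    CountInv F.tree 0 (forestInput F) := by
  refine ⟨?_, ?_, ?_, ?_, fun i hi => ?_, fun u => ?_, fun x hx => ?_, fun a ha i => ?_⟩
  · simp [forestInput]
  · simp [forestInput]
  · simp [forestInput]
  · simp [forestInput]
  · rw [forestInput]
    exact (dif_pos (⟨rfl, hi⟩ : 0 = 0 ∧ i < n)).trans (F.tree_par ⟨i, hi⟩).symm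
  · simp [forestInput]
  · obtain rfl : x = 0 := by omega
    simp [forestInput]
  · simp [forestInput, show a ≠ 0 by omega]

theorem size_le_log_add_one (x : ℕ) : Nat.size x ≤ Nat.log 2 x + 1 :=
  Nat.size_le.2 (Nat.lt_pow_succ_log_self one_lt_two x)

theorem fits_of_log_le {n w : ℕ} (h : 22 * (Nat.log 2 n + 1) ≤ w) : Fits n w := by
  have h1 := size_le_log_add_one n
  have h2 : expBits n ≤ 2 * Nat.size n + 4 := Nat.size_le.2 Nat.lt_two_pow_self
  refine ⟨by rw [labelLength]; omega, ?_⟩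
  have h3 : n + 1 ≤ 2 ^ (Nat.log 2 n + 1) := Nat.lt_pow_succ_log_self one_lt_two n
  calc 8 * ((n + 1) * (n + 1))
      ≤ 8 * (2 ^ (Nat.log 2 n + 1) * 2 ^ (Nat.log 2 n + 1)) := by gcongr
    _ = 2 ^ (2 * (Nat.log 2 n + 1) + 3) := by ring
    _ < 2 ^ w := Nat.pow_lt_pow_right one_lt_two (by omega)

theorem assignsLabels_marker {n w : ℕ} (F : RootedForest n) (hw : Fits n w) :
    AssignsLabels markerProgram intervalScheme F w (420 * (n + 1)) := by
  obtain ⟨t, s, he, ht, hs⟩ := marker_runs hw (forestInput_countInv F)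
  refine ⟨t, s, he, ht, fun v => ?_⟩
  rw [length_label, bitsValue_label]
  exact hs v v.2

theorem answersQuery_query {n₁ n₂ w : ℕ} (F₁ : RootedForest n₁) (F₂ : RootedForest n₂)
    (v₁ : Fin n₁) (v₂ : Fin n₂) (h₁ : Fits n₁ w) (h₂ : Fits n₂ w) :
    AnswersQuery queryProgram intervalScheme (intervalScheme.label F₁ v₁)
      (intervalScheme.label F₂ v₂) w 100 := by
  have hv₁ : (v₁ + 1 : ℕ) ≤ n₁ := v₁.2
  have hm₁ := h₁.labelLength_lt
  have hm₂ := h₂.labelLength_lt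
  rw [labelLength] at hm₁ hm₂
  have hb := F₁.tree.blockEnd_le hv₁
  have hp := F₁.tree.pos_add_width_le (expBits n₁) hv₁
  have hw₀ := F₁.tree.width_le' (Nat.zero_le _)
  have hw₁ := extent_le (T := F₁.tree) hv₁
  have hN := h₁.lt
  refine queryProgram_runs (X := F₁.tree.labelValue (v₁ + 1)) (Y := F₂.tree.labelValue (v₂ + 1))
    (bitsValue_label F₁ v₁) (bitsValue_label F₂ v₂) ?_ ?_ ?_ ?_ |>.mono le_rfl ?_
  · exact (F₁.tree.labelValue_lt hv₁).trans_le
      (Nat.pow_le_pow_right two_pos h₁.labelLength_le)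
  · have := F₁.tree.width_pos (expBits n₁) (v₁ + 1)
    omega
  · rw [ParentTree.labelValue, padicValNat_packLabel]
    omega
  · rw [ParentTree.labelValue, padicValNat_packLabel]
    omega
  · intro s hs
    rw [hs, ← bitsValue_label, ← bitsValue_label]
    rfl

end WordRAM

/-! ### The length of the labels -/

theorem labelLength_le {n : ℕ} (hn : 16 ≤ n) :
    (labelLength n : ℝ) ≤ Real.logb 2 n + 3 * Real.logb 2 (Real.logb 2 n) + 13 := by
  have hx : 4 ≤ Real.logb 2 n := by
    rw [Real.le_logb_iff_rpow_le one_lt_two (by positivity)]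
    calc (2 : ℝ) ^ (4 : ℝ) = 16 := by norm_num
      _ ≤ n := by exact_mod_cast hn
  have h1 : (Nat.size n : ℝ) ≤ Real.logb 2 n + 1 := by
    have h := WordRAM.size_le_log_add_one n
    have h' := Real.natLog_le_logb n 2
    have : (Nat.size n : ℝ) ≤ Nat.log 2 n + 1 := by exact_mod_cast h
    push_cast at h'
    linarith
  have h2 : (expBits n : ℝ) ≤ Real.logb 2 (Real.logb 2 n) + 3 := by
    have h := WordRAM.size_le_log_add_one (2 * Nat.size n + 4)
    have h' := Real.natLog_le_logb (2 * Nat.size n + 4) 2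
    have h3 : (expBits n : ℝ) ≤ Nat.log 2 (2 * Nat.size n + 4) + 1 := by exact_mod_cast h
    have h4 : Real.logb 2 ((2 * Nat.size n + 4 : ℕ) : ℝ) ≤ Real.logb 2 (2 ^ 2 * Real.logb 2 n) := by
      refine Real.logb_le_logb_of_le one_lt_two (by positivity) ?_
      push_cast
      linarith
    rw [Real.logb_mul (by norm_num) (by linarith), Real.logb_pow, Real.logb_self_eq_one one_lt_two]
      at h4
    push_cast at h' h4
    linarith
  rw [labelLength]
  push_cast
  linarith

theorem one_isBigO_logb_logb_logb :
    (fun _ : ℕ => (1 : ℝ)) =O[Filter.atTop]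
      fun n : ℕ => Real.logb 2 (Real.logb 2 (Real.logb 2 (n : ℝ))) := by
  have h := Real.tendsto_logb_atTop one_lt_two
  refine ((Asymptotics.isLittleO_one_left_iff ℝ).2 (tendsto_norm_atTop_atTop.comp
    (h.comp (h.comp (h.comp tendsto_natCast_atTop_atTop))))).isBigO

theorem theorem4p5 :
    ∃ (S : AncestryLabelingScheme) (f : ℕ → ℝ) (marker decoder : WordRAM.Program) (c : ℕ),
      -- the label size
      (f =O[Filter.atTop] fun n : ℕ => Real.logb 2 (Real.logb 2 (Real.logb 2 (n : ℝ)))) ∧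
      (∀ (n : ℕ) (F : RootedForest n) (v : Fin n),
        ((S.label F v).length : ℝ) ≤
          Real.logb 2 (n : ℝ) + 3 * Real.logb 2 (Real.logb 2 (n : ℝ)) + f n) ∧
      -- linear-time labeling on every word RAM with sufficiently large words of `Ω(log n)` bits
      (∀ (n : ℕ) (F : RootedForest n) (w : ℕ), c * (Nat.log 2 n + 1) ≤ w →
        WordRAM.AssignsLabels marker S F w (c * (n + 1))) ∧
      -- constant query time, for any two labels of nodes of forests with at most `n` nodes
      (∀ (n n₁ n₂ : ℕ) (F₁ : RootedForest n₁) (F₂ : RootedForest n₂) (v₁ : Fin n₁) (v₂ : Fin n₂)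
        (w : ℕ), n₁ ≤ n → n₂ ≤ n → c * (Nat.log 2 n + 1) ≤ w →
        WordRAM.AnswersQuery decoder S (S.label F₁ v₁) (S.label F₂ v₂) w c) := by
  refine ⟨intervalScheme, fun n => if n < 16 then
      labelLength n - (Real.logb 2 n + 3 * Real.logb 2 (Real.logb 2 n)) else 13,
    WordRAM.markerProgram, WordRAM.queryProgram, 420, ?_, ?_, ?_, ?_⟩
  · refine (one_isBigO_logb_logb_logb.const_mul_left 13).congr' ?_ .rfl
    filter_upwards [Filter.eventually_ge_atTop 16] with n hn
    rw [if_neg (by omega), mul_one]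
  · intro n F v
    rw [length_label]
    dsimp only
    split_ifs with h
    · linarith
    · exact labelLength_le (by omega)
  · intro n F w hw
    exact WordRAM.assignsLabels_marker F (WordRAM.fits_of_log_le (by omega))
  · intro n n₁ n₂ F₁ F₂ v₁ v₂ w h₁ h₂ hw
    have h₁' : Nat.log 2 n₁ ≤ Nat.log 2 n := Nat.log_mono_right h₁
    have h₂' : Nat.log 2 n₂ ≤ Nat.log 2 n := Nat.log_mono_right h₂
    obtain ⟨t, s, he, ht, hs⟩ := WordRAM.answersQuery_query F₁ F₂ v₁ v₂
      (WordRAM.fits_of_log_le (w := w) (by omega)) (WordRAM.fits_of_log_le (by omega))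
    exact ⟨t, s, he, by omega, hs⟩
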